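/- Let $n\in\mathbb N$ and $\Omega=\{(t,y)\in\mathbb R\times\mathbb R^n : 0<t<1,\ |y|<1\}\subset\mathbb R^{1+n}$. Let $u,v$ be real-valued functions that are $C^\infty$ on the closure $\overline\Omega$ (smooth up to the boundary), with $$u\ge v,\qquad u>0,\qquad v>0,\qquad u_t>0\qquad\text{in }\Omega,$$ and $u(0,y)=0$ for $|y|<1$. Let $\Delta=\partial_t^2+\sum_{i=1}^n\partial_{y_i}^2$, and assume the main condition: whenever $u(t,y)=v(s,y)$ for some $0<t\le s<1$ and $|y|<1$, then $\Delta u(t,y)\le\Delta v(s,y)$. Assume moreover that $u_t(0,0)=0$; that $u(t,0)$ and $v(t,0)$ vanish at $t=0$ to finite order, i.e. there are finite smallest integers $k$ and $l$ with $\partial_t^k u(0,0)\ne0$ and $\partial_t^l v(0,0)\neq 0$; and that $\nabla_y u_{tt}(0,0)=0$. If $k=2$ or $k=3$, then $u\equiv v$ on $\overline\Omega$. -/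

import Mathlib

open Set
open scoped ContDiff Laplacian Gradient

/-- Euclidean space `ℝ^{1+n}` with points `(t, y)`, `t ∈ ℝ`, `y ∈ ℝⁿ` (the `L²` product, so that
it carries the Euclidean norm and inner product). -/
abbrev SpaceTime (n : ℕ) : Type := WithLp 2 (ℝ × EuclideanSpace ℝ (Fin n))

/-- The point `(t, y)` of `ℝ^{1+n}`. -/
def pt {n : ℕ} (t : ℝ) (y : EuclideanSpace ℝ (Fin n)) : SpaceTime n := WithLp.toLp 2 (t, y)

/-- The domain `Ω = {(t, y) : 0 < t < 1, |y| < 1}`. -/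
def domainΩ (n : ℕ) : Set (SpaceTime n) := {p | 0 < p.fst ∧ p.fst < 1 ∧ ‖p.snd‖ < 1}

/-- The `i`-th partial derivative in `t` at time `t = 0` and position `y`, i.e. `∂ₜⁱ w (0, y)`,
for a function `w` on the closure of `Ω`; it is one-sided, within `0 ≤ t ≤ 1`. -/
noncomputable def timeDerivZero {n : ℕ} (i : ℕ) (w : SpaceTime n → ℝ)
    (y : EuclideanSpace ℝ (Fin n)) : ℝ :=
  iteratedDerivWithin i (fun t : ℝ => w (pt t y)) (Icc 0 1) 0

/-- `k` is the order of the first `t`-derivative of `w` that does not vanish at the origin;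
`w (·, 0)` vanishes to finite order at `t = 0` if and only if such a `k` exists. -/
def IsVanishingOrder {n : ℕ} (w : SpaceTime n → ℝ) (k : ℕ) : Prop :=
  (∀ i < k, timeDerivZero i w 0 = 0) ∧ timeDerivZero k w 0 ≠ 0

/-- The main condition: whenever `u (t, y) = v (s, y)` for `0 < t ≤ s < 1`, `|y| < 1`, there
`Δ u (t, y) ≤ Δ v (s, y)`, where `Δ` is the full Laplacian of `ℝ^{1+n}`. -/
def MainCondition {n : ℕ} (u v : SpaceTime n → ℝ) : Prop :=
  ∀ (t s : ℝ) (y : EuclideanSpace ℝ (Fin n)), 0 < t → t ≤ s → s < 1 → ‖y‖ < 1 →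
    u (pt t y) = v (pt s y) → (Δ u) (pt t y) ≤ (Δ v) (pt s y)

/-!
Since `∂ₜ u > 0` and `0 ≤ v ≤ u`, every point `(s, y)` of the cylinder has a unique `t ≤ s` with
`u (t, y) = v (s, y)`, and the functions agree at `(s, y)` exactly when the time shift `s - t`
vanishes there. The main condition makes the shift, in a weak form, a supersolution of an elliptic
equation: if a quadratic polynomial touches it from below, the second derivative test along an
orthonormal basis turns `Δ u (t, y) ≤ Δ v (s, y)` into a differential inequality for the polynomial
whose coefficients only involve `∂ₜ u` and its gradient (`touching_le`). The polynomials used are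
Hopf barriers, and a barrier for which the strict opposite inequality holds stays below the shift
(`Admissible.barrier_le`). No regularity of the shift is needed.

With barriers at interior points this gives the strong maximum principle: `u` and `v` agree
everywhere or nowhere in the open cylinder (`Admissible.lt_of_exists_lt`). In the second case, a
barrier at the origin gives a Hopf lemma (`Admissible.exists_shift_origin`): `t ≤ (1 - ε) s` on the
time axis near the origin. The equation degenerates there, because `∂ₜ u` vanishes at the origin,
but the lower bound for `∂ₜ² u` that follows from the order `2` or `3`, together with
`|∇ ∂ₜ u|² ≤ C ∂ₜ u` in horizontal directions, still allows a barrier. Consequently the leading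
coefficient of `v` on the axis is strictly smaller than that of `u` when the orders are equal
(`Admissible.leading_coeff_le`).

The main condition near the axis yields the opposite inequality. In order `2` it suffices to take
the limit of the main condition along the axis. In order `3` the Laplacians vanish at the origin,
and `∂ₜ Δ u (0, 0)` is the sum of `∂ₜ³ u (0, 0)` and the nonnegative `∂ₜ ∂ᵢ² u (0, 0)`. To eliminate
the latter, the condition is used at pairs of points symmetric about the axis, at distance
`(Δ v) ^ (3 / 4)` from it in each coordinate direction; this bounds `∂ᵢ² v (s, 0)` in terms of
`Δ v (s, 0)`, and summing over `i` leaves `∂ₜ³ u (0, 0) t ≲ ∂ₜ² v (s, 0)`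
(`Admissible.eventually_mul_le_second_deriv`). As `v` vanishes to finite order on the axis, this
forces order `3` and a leading coefficient at least that of `u`, which contradicts the Hopf lemma.
-/

open Filter Topology

/-! ### Geometry of the cylinder -/

@[simp] lemma pt_fst {n : ℕ} (t : ℝ) (y : EuclideanSpace ℝ (Fin n)) : (pt t y).fst = t := rfl

@[simp] lemma pt_snd {n : ℕ} (t : ℝ) (y : EuclideanSpace ℝ (Fin n)) : (pt t y).snd = y := rfl

lemma pt_eta {n : ℕ} (p : SpaceTime n) : pt p.fst p.snd = p := rfl

@[simp] lemma pt_zero_zero {n : ℕ} : pt 0 (0 : EuclideanSpace ℝ (Fin n)) = 0 := rfl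

lemma pt_add {n : ℕ} (t s : ℝ) (y z : EuclideanSpace ℝ (Fin n)) :
    pt t y + pt s z = pt (t + s) (y + z) := rfl

lemma pt_sub {n : ℕ} (t s : ℝ) (y z : EuclideanSpace ℝ (Fin n)) :
    pt t y - pt s z = pt (t - s) (y - z) := rfl

lemma smul_pt {n : ℕ} (c t : ℝ) (y : EuclideanSpace ℝ (Fin n)) :
    c • pt t y = pt (c * t) (c • y) := rfl

lemma inner_spaceTime {n : ℕ} (p q : SpaceTime n) :
    inner ℝ p q = p.fst * q.fst + inner ℝ p.snd q.snd := by
  rw [WithLp.prod_inner_apply]; simp [mul_comm]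

lemma norm_sq_spaceTime {n : ℕ} (p : SpaceTime n) : ‖p‖ ^ 2 = p.fst ^ 2 + ‖p.snd‖ ^ 2 := by
  rw [← real_inner_self_eq_norm_sq, inner_spaceTime, real_inner_self_eq_norm_sq]; ring

/-- The unit vector in the direction of time. -/
def timeDir (n : ℕ) : SpaceTime n := pt 1 0

@[simp] lemma timeDir_fst (n : ℕ) : (timeDir n).fst = 1 := rfl

@[simp] lemma timeDir_snd (n : ℕ) : (timeDir n).snd = 0 := rfl

@[simp] lemma norm_timeDir (n : ℕ) : ‖timeDir n‖ = 1 := by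
  have h := norm_sq_spaceTime (timeDir n)
  simp only [timeDir_fst, timeDir_snd, norm_zero] at h
  nlinarith [norm_nonneg (timeDir n)]

lemma inner_timeDir {n : ℕ} (p : SpaceTime n) : inner ℝ p (timeDir n) = p.fst := by
  rw [inner_spaceTime]; simp

lemma pt_add_smul_timeDir {n : ℕ} (t h : ℝ) (y : EuclideanSpace ℝ (Fin n)) :
    pt t y + h • timeDir n = pt (t + h) y := by
  simp [timeDir, smul_pt, pt_add]

lemma pt_eq_add {n : ℕ} (t : ℝ) (y : EuclideanSpace ℝ (Fin n)) :
    pt t y = t • timeDir n + pt 0 y := by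
  simp [timeDir, smul_pt, pt_add]

@[fun_prop] lemma continuous_pt {n : ℕ} {X : Type*} [TopologicalSpace X] {f : X → ℝ}
    {g : X → EuclideanSpace ℝ (Fin n)} (hf : Continuous f) (hg : Continuous g) :
    Continuous fun x => pt (f x) (g x) := by
  unfold pt
  exact (WithLp.prod_continuous_toLp 2 _ _).comp (hf.prodMk hg)

@[fun_prop] lemma continuous_fst' {n : ℕ} : Continuous fun p : SpaceTime n => p.fst :=
  continuous_fst.comp (WithLp.prod_continuous_ofLp 2 _ _)

@[fun_prop] lemma continuous_snd' {n : ℕ} : Continuous fun p : SpaceTime n => p.snd :=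
  continuous_snd.comp (WithLp.prod_continuous_ofLp 2 _ _)

lemma mem_domainΩ {n : ℕ} {p : SpaceTime n} :
    p ∈ domainΩ n ↔ 0 < p.fst ∧ p.fst < 1 ∧ ‖p.snd‖ < 1 := Iff.rfl

lemma isOpen_domainΩ (n : ℕ) : IsOpen (domainΩ n) :=
  (isOpen_lt continuous_const continuous_fst').inter
    ((isOpen_lt continuous_fst' continuous_const).inter
      (isOpen_lt continuous_snd'.norm continuous_const))

lemma mem_closure_domainΩ {n : ℕ} {p : SpaceTime n} :
    p ∈ closure (domainΩ n) ↔ 0 ≤ p.fst ∧ p.fst ≤ 1 ∧ ‖p.snd‖ ≤ 1 := by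
  constructor
  · intro hp
    have hc : IsClosed {p : SpaceTime n | 0 ≤ p.fst ∧ p.fst ≤ 1 ∧ ‖p.snd‖ ≤ 1} :=
      (isClosed_le continuous_const continuous_fst').inter
        ((isClosed_le continuous_fst' continuous_const).inter
          (isClosed_le continuous_snd'.norm continuous_const))
    have hsub : domainΩ n ⊆ {p : SpaceTime n | 0 ≤ p.fst ∧ p.fst ≤ 1 ∧ ‖p.snd‖ ≤ 1} :=
      fun q hq => ⟨hq.1.le, hq.2.1.le, hq.2.2.le⟩
    exact closure_minimal hsub hc hp
  · rintro ⟨h0, h1, h2⟩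
    -- move `p` towards the centre `(1/2, 0)` of the cylinder
    let f : ℝ → SpaceTime n := fun r => pt ((1 - r) * p.fst + r / 2) ((1 - r) • p.snd)
    have hf : Tendsto f (𝓝[>] 0) (𝓝 p) := by
      have : Continuous f := by fun_prop
      have h := (this.tendsto 0).mono_left (nhdsWithin_le_nhds (s := Ioi 0))
      simpa [f, pt_eta] using h
    refine mem_closure_of_tendsto hf ?_
    filter_upwards [Ioo_mem_nhdsGT (zero_lt_one (α := ℝ))] with r hr
    have hr' : 0 < 1 - r := by linarith [hr.2]
    refine ⟨?_, ?_, ?_⟩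
    · simp only [f, pt_fst]; nlinarith [hr.1]
    · simp only [f, pt_fst]; nlinarith [hr.1]
    · simp only [f, pt_snd, norm_smul, Real.norm_of_nonneg hr'.le]; nlinarith [hr.1]

lemma pt_mem_closure {n : ℕ} {t : ℝ} {y : EuclideanSpace ℝ (Fin n)} (h0 : 0 ≤ t) (h1 : t ≤ 1)
    (hy : ‖y‖ ≤ 1) : pt t y ∈ closure (domainΩ n) := mem_closure_domainΩ.2 ⟨h0, h1, hy⟩

lemma zero_mem_closure (n : ℕ) : (0 : SpaceTime n) ∈ closure (domainΩ n) :=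
  pt_mem_closure le_rfl zero_le_one (by simp)

lemma convex_domainΩ (n : ℕ) : Convex ℝ (domainΩ n) := by
  intro p hp q hq a b ha hb hab
  have h1 : (a • p + b • q).fst = a * p.fst + b * q.fst := rfl
  have h2 : (a • p + b • q).snd = a • p.snd + b • q.snd := rfl
  refine ⟨?_, ?_, ?_⟩
  · rw [h1]
    exact (convex_Ioi (0 : ℝ)) hp.1 hq.1 ha hb hab
  · rw [h1]
    exact (convex_Iio (1 : ℝ)) hp.2.1 hq.2.1 ha hb hab
  · rw [h2]
    have := (convex_ball (0 : EuclideanSpace ℝ (Fin n)) 1) (by simpa using hp.2.2)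
      (by simpa using hq.2.2) ha hb hab
    simpa using this

lemma convex_closure_domainΩ (n : ℕ) : Convex ℝ (closure (domainΩ n)) := (convex_domainΩ n).closure

lemma domainΩ_nonempty (n : ℕ) : (domainΩ n).Nonempty :=
  ⟨pt (1 / 2) 0, by rw [mem_domainΩ]; norm_num⟩

lemma isCompact_closure_domainΩ (n : ℕ) : IsCompact (closure (domainΩ n)) := by
  refine Metric.isCompact_of_isClosed_isBounded isClosed_closure ?_
  refine (Metric.isBounded_closedBall (x := (0 : SpaceTime n)) (r := 2)).subset fun p hp => ?_
  obtain ⟨h0, h1, h2⟩ := mem_closure_domainΩ.1 hp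
  rw [mem_closedBall_zero_iff]
  have := norm_sq_spaceTime p
  nlinarith [norm_nonneg p, norm_nonneg p.snd]

lemma uniqueDiffOn_closure_domainΩ (n : ℕ) : UniqueDiffOn ℝ (closure (domainΩ n)) :=
  uniqueDiffOn_convex (convex_closure_domainΩ n)
    ((domainΩ_nonempty n).mono (interior_maximal subset_closure (isOpen_domainΩ n)))

lemma closure_mem_nhds {n : ℕ} {p : SpaceTime n} (hp : p ∈ domainΩ n) :
    closure (domainΩ n) ∈ 𝓝 p :=
  mem_of_superset ((isOpen_domainΩ n).mem_nhds hp) subset_closure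

/-! ### Directional derivatives up to the boundary -/

/-- First order Taylor expansion with a remainder that is uniform on a compact convex set. -/
theorem ContDiffOn.exists_first_order_bound {E : Type*} [NormedAddCommGroup E] [NormedSpace ℝ E]
    {s : Set E} {f : E → ℝ} (hf : ContDiffOn ℝ 2 f s) (hs : UniqueDiffOn ℝ s)
    (hconv : Convex ℝ s) (hcomp : IsCompact s) :
    ∃ C, 0 ≤ C ∧ ∀ p ∈ s, ∀ q ∈ s,
      |f q - f p - fderivWithin ℝ f s p (q - p)| ≤ C * ‖q - p‖ ^ 2 := by
  obtain ⟨K, hK⟩ := (hf.fderivWithin hs (m := 1) (by norm_num)).exists_lipschitzOnWith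
    one_ne_zero hconv hcomp
  refine ⟨K, K.2, fun p hp q hq => ?_⟩
  have hseg : segment ℝ p q ⊆ s := hconv.segment_subset hp hq
  have := (convex_segment p q).norm_image_sub_le_of_norm_hasFDerivWithin_le' (f := f)
    (f' := fderivWithin ℝ f s) (φ := fderivWithin ℝ f s p) (C := K * ‖q - p‖)
    (fun x hx => ((hf.differentiableOn (by norm_num)) x (hseg hx)).hasFDerivWithinAt.mono hseg)
    (fun x hx => ?_) (left_mem_segment ℝ p q) (right_mem_segment ℝ p q)
  · rw [pow_two, ← mul_assoc]; exact this
  · refine (hK.norm_sub_le (hseg hx) hp).trans ?_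
    gcongr
    obtain ⟨a, b, ha, hb, hab, rfl⟩ := hx
    have : a • p + b • q - p = b • (q - p) := by
      rw [← eq_sub_iff_add_eq] at hab; subst hab; module
    rw [this, norm_smul, Real.norm_of_nonneg hb]
    exact mul_le_of_le_one_left (norm_nonneg _) (by linarith)

lemma two_le_infty : (2 : WithTop ℕ∞) ≤ ∞ := by
  change ((2 : ℕ∞) : WithTop ℕ∞) ≤ ((⊤ : ℕ∞) : WithTop ℕ∞)
  exact WithTop.coe_le_coe.2 le_top

/-- The directional derivative `∂ₑ w` on the closure of `Ω`, one-sided at the boundary. -/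
noncomputable def dirDeriv {n : ℕ} (e : SpaceTime n) (w : SpaceTime n → ℝ) (p : SpaceTime n) : ℝ :=
  fderivWithin ℝ w (closure (domainΩ n)) p e

section dirDeriv

variable {n : ℕ} {w : SpaceTime n → ℝ}

lemma contDiffOn_dirDeriv (hw : ContDiffOn ℝ ∞ w (closure (domainΩ n))) (e : SpaceTime n) :
    ContDiffOn ℝ ∞ (dirDeriv e w) (closure (domainΩ n)) :=
  (hw.fderivWithin (uniqueDiffOn_closure_domainΩ n) (by simp)).clm_apply contDiffOn_const

lemma dirDeriv_eq_fderiv {p : SpaceTime n} (hp : p ∈ domainΩ n) (e : SpaceTime n) :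
    dirDeriv e w p = fderiv ℝ w p e := by
  rw [dirDeriv, fderivWithin_of_mem_nhds (closure_mem_nhds hp)]

lemma dirDeriv_add_dir (e f p : SpaceTime n) :
    dirDeriv (e + f) w p = dirDeriv e w p + dirDeriv f w p := map_add _ _ _

lemma dirDeriv_smul_dir (c : ℝ) (e p : SpaceTime n) :
    dirDeriv (c • e) w p = c * dirDeriv e w p := map_smul _ _ _

lemma dirDeriv_neg_dir (e p : SpaceTime n) : dirDeriv (-e) w p = -dirDeriv e w p := map_neg _ _

lemma hasFDerivAt_of_mem (hw : ContDiffOn ℝ ∞ w (closure (domainΩ n))) {p : SpaceTime n}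
    (hp : p ∈ domainΩ n) : HasFDerivAt w (fderiv ℝ w p) p :=
  ((hw.contDiffAt (closure_mem_nhds hp)).differentiableAt (by simp)).hasFDerivAt

lemma contDiffAt_fderiv (hw : ContDiffOn ℝ ∞ w (closure (domainΩ n))) {p : SpaceTime n}
    (hp : p ∈ domainΩ n) : ContDiffAt ℝ ∞ (fderiv ℝ w) p :=
  (hw.contDiffAt (closure_mem_nhds hp)).fderiv_right (by simp)

lemma hasFDerivAt_fderiv (hw : ContDiffOn ℝ ∞ w (closure (domainΩ n))) {p : SpaceTime n}
    (hp : p ∈ domainΩ n) : HasFDerivAt (fderiv ℝ w) (fderiv ℝ (fderiv ℝ w) p) p :=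
  ((contDiffAt_fderiv hw hp).differentiableAt (by simp)).hasFDerivAt

lemma fderiv_fderiv_eq_dirDeriv (hw : ContDiffOn ℝ ∞ w (closure (domainΩ n))) {p : SpaceTime n}
    (hp : p ∈ domainΩ n) (e f : SpaceTime n) :
    fderiv ℝ (fderiv ℝ w) p e f = dirDeriv e (dirDeriv f w) p := by
  rw [dirDeriv_eq_fderiv hp]
  have h1 : dirDeriv f w =ᶠ[𝓝 p] fun q => fderiv ℝ w q f := by
    filter_upwards [(isOpen_domainΩ n).mem_nhds hp] with q hq using dirDeriv_eq_fderiv hq f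
  have h2 := (hasFDerivAt_fderiv hw hp).clm_apply (hasFDerivAt_const f p)
  rw [h1.fderiv_eq, h2.fderiv]
  simp

lemma dirDeriv_comm (hw : ContDiffOn ℝ ∞ w (closure (domainΩ n))) {p : SpaceTime n}
    (hp : p ∈ closure (domainΩ n)) (e f : SpaceTime n) :
    dirDeriv e (dirDeriv f w) p = dirDeriv f (dirDeriv e w) p := by
  have key : EqOn (dirDeriv e (dirDeriv f w)) (dirDeriv f (dirDeriv e w)) (domainΩ n) := by
    intro q hq
    rw [← fderiv_fderiv_eq_dirDeriv hw hq, ← fderiv_fderiv_eq_dirDeriv hw hq]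
    exact ((hw.contDiffAt (closure_mem_nhds hq)).isSymmSndFDerivAt
      (by simpa using two_le_infty)) e f
  exact key.of_subset_closure
    (contDiffOn_dirDeriv (contDiffOn_dirDeriv hw f) e).continuousOn
    (contDiffOn_dirDeriv (contDiffOn_dirDeriv hw e) f).continuousOn subset_closure
    subset_rfl hp

lemma hasDerivWithinAt_line (hw : ContDiffOn ℝ ∞ w (closure (domainΩ n))) {p e : SpaceTime n}
    {I : Set ℝ} (hI : ∀ h ∈ I, p + h • e ∈ closure (domainΩ n)) {h : ℝ} (hh : h ∈ I) :
    HasDerivWithinAt (fun h => w (p + h • e)) (dirDeriv e w (p + h • e)) I h := by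
  have h1 : HasFDerivWithinAt w (fderivWithin ℝ w (closure (domainΩ n)) (p + h • e))
      (closure (domainΩ n)) (p + h • e) :=
    ((hw.differentiableOn (by simp)) _ (hI h hh)).hasFDerivWithinAt
  have h2 : HasDerivWithinAt (fun h : ℝ => p + h • e) e I h := by
    simpa using ((hasDerivAt_id h).smul_const e).const_add p |>.hasDerivWithinAt
  exact h1.comp_hasDerivWithinAt h h2 hI

lemma hasDerivWithinAt_time (hw : ContDiffOn ℝ ∞ w (closure (domainΩ n)))
    {y : EuclideanSpace ℝ (Fin n)} (hy : ‖y‖ ≤ 1) {t : ℝ} (ht : t ∈ Icc (0 : ℝ) 1) :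
    HasDerivWithinAt (fun t => w (pt t y)) (dirDeriv (timeDir n) w (pt t y)) (Icc 0 1) t := by
  have := hasDerivWithinAt_line hw (p := pt 0 y) (e := timeDir n) (I := Icc 0 1)
    (fun h hh => by rw [pt_add_smul_timeDir]; exact pt_mem_closure (by simpa using hh.1)
                      (by simpa using hh.2) hy) ht
  simpa only [pt_add_smul_timeDir, zero_add] using this

lemma exists_taylor_bound (hw : ContDiffOn ℝ ∞ w (closure (domainΩ n))) :
    ∃ C, 0 ≤ C ∧ ∀ p ∈ closure (domainΩ n), ∀ q ∈ closure (domainΩ n),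
      |w q - w p - dirDeriv (q - p) w p| ≤ C * ‖q - p‖ ^ 2 :=
  (hw.of_le two_le_infty).exists_first_order_bound (uniqueDiffOn_closure_domainΩ n)
    (convex_closure_domainΩ n) (isCompact_closure_domainΩ n)

lemma exists_lipschitz_bound (hw : ContDiffOn ℝ ∞ w (closure (domainΩ n))) :
    ∃ C, 0 ≤ C ∧ ∀ p ∈ closure (domainΩ n), ∀ q ∈ closure (domainΩ n),
      |w q - w p| ≤ C * ‖q - p‖ := by
  obtain ⟨K, hK⟩ := hw.exists_lipschitzOnWith (by simp) (convex_closure_domainΩ n)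
    (isCompact_closure_domainΩ n)
  exact ⟨K, K.2, fun p hp q hq => hK.norm_sub_le hq hp⟩

lemma iteratedDerivWithin_time (hw : ContDiffOn ℝ ∞ w (closure (domainΩ n)))
    {y : EuclideanSpace ℝ (Fin n)} (hy : ‖y‖ ≤ 1) (i : ℕ) :
    EqOn (iteratedDerivWithin i (fun t => w (pt t y)) (Icc 0 1))
      (fun t => (dirDeriv (timeDir n))^[i] w (pt t y)) (Icc 0 1) ∧
    ContDiffOn ℝ ∞ ((dirDeriv (timeDir n))^[i] w) (closure (domainΩ n)) := by
  induction i with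
  | zero => exact ⟨fun t ht => by simp, by simpa using hw⟩
  | succ i ih =>
    rw [Function.iterate_succ']
    refine ⟨fun t ht => ?_, contDiffOn_dirDeriv ih.2 _⟩
    rw [iteratedDerivWithin_succ, derivWithin_congr ih.1 (ih.1 ht)]
    exact (hasDerivWithinAt_time ih.2 hy ht).derivWithin (uniqueDiffOn_Icc zero_lt_one t ht)

lemma timeDerivZero_eq (hw : ContDiffOn ℝ ∞ w (closure (domainΩ n)))
    {y : EuclideanSpace ℝ (Fin n)} (hy : ‖y‖ ≤ 1) (i : ℕ) :
    timeDerivZero i w y = (dirDeriv (timeDir n))^[i] w (pt 0 y) :=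
  (iteratedDerivWithin_time hw hy i).1 ⟨le_rfl, zero_le_one⟩

end dirDeriv

/-- The Laplacian of a function on the cylinder, continued to the closure of `Ω` through the
one-sided second derivatives in the coordinate directions. -/
noncomputable def closedLaplacian {n : ℕ} (w : SpaceTime n → ℝ) (p : SpaceTime n) : ℝ :=
  dirDeriv (timeDir n) (dirDeriv (timeDir n) w) p +
    ∑ i, dirDeriv (pt 0 (EuclideanSpace.single i 1))
      (dirDeriv (pt 0 (EuclideanSpace.single i 1)) w) p

lemma laplacian_eq_sum {n : ℕ} {w : SpaceTime n → ℝ}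
    (hw : ContDiffOn ℝ ∞ w (closure (domainΩ n))) {p : SpaceTime n} (hp : p ∈ domainΩ n)
    {ι : Type*} [Fintype ι] (b : OrthonormalBasis ι ℝ (SpaceTime n)) :
    (Δ w) p = ∑ i, dirDeriv (b i) (dirDeriv (b i) w) p := by
  rw [InnerProductSpace.laplacian_eq_iteratedFDeriv_orthonormalBasis w b]
  simp only [iteratedFDeriv_two_apply]
  exact Finset.sum_congr rfl fun i _ => by simp [← fderiv_fderiv_eq_dirDeriv hw hp]

lemma laplacian_eq_closedLaplacian {n : ℕ} {w : SpaceTime n → ℝ}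
    (hw : ContDiffOn ℝ ∞ w (closure (domainΩ n))) {p : SpaceTime n} (hp : p ∈ domainΩ n) :
    (Δ w) p = closedLaplacian w p := by
  rw [laplacian_eq_sum hw hp
    ((OrthonormalBasis.singleton Unit ℝ).prod (EuclideanSpace.basisFun (Fin n) ℝ))]
  simp only [OrthonormalBasis.prod_apply, Fintype.sum_sum_type]
  simp [closedLaplacian, timeDir, pt]

lemma contDiffOn_closedLaplacian {n : ℕ} {w : SpaceTime n → ℝ}
    (hw : ContDiffOn ℝ ∞ w (closure (domainΩ n))) :
    ContDiffOn ℝ ∞ (closedLaplacian w) (closure (domainΩ n)) :=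
  (contDiffOn_dirDeriv (contDiffOn_dirDeriv hw _) _).add
    (ContDiffOn.sum fun _ _ => contDiffOn_dirDeriv (contDiffOn_dirDeriv hw _) _)

/-! ### Touching from below by a quadratic barrier -/

/-- The second derivative test, as a necessary condition. -/
lemma IsLocalMin.second_deriv_nonneg {f f' : ℝ → ℝ} {x c : ℝ} (hmin : IsLocalMin f x)
    (hf : ∀ᶠ h in 𝓝 x, HasDerivAt f (f' h) h) (hf' : HasDerivAt f' c x) : 0 ≤ c := by
  by_contra! hc
  have hd : deriv f =ᶠ[𝓝 x] f' := hf.mono fun h hh => hh.deriv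
  have hmax : IsLocalMax f x := by
    refine isLocalMax_of_deriv_deriv_neg ?_ hmin.deriv_eq_zero hf.self_of_nhds.continuousAt
    rw [hd.deriv_eq, hf'.deriv]
    exact hc
  -- a point that is both a local minimum and a local maximum makes `f` locally constant
  have hconst : f =ᶠ[𝓝 x] fun _ => f x := by
    filter_upwards [hmin, hmax] with h h1 h2 using le_antisymm h2 h1
  have h0 : f' =ᶠ[𝓝 x] fun _ => 0 := by
    filter_upwards [hd, hconst.deriv] with h h1 h2
    rw [← h1, h2, deriv_const]
  have : c = 0 := by rw [← hf'.deriv, h0.deriv_eq, deriv_const]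
  exact hc.ne this

/-- Functions `u ≥ v > 0` on `Ω`, smooth up to the boundary, with `u` increasing in time from the
initial value `0`, and subject to the main condition. -/
structure Admissible {n : ℕ} (u v : SpaceTime n → ℝ) : Prop where
  smooth_u : ContDiffOn ℝ ∞ u (closure (domainΩ n))
  smooth_v : ContDiffOn ℝ ∞ v (closure (domainΩ n))
  le : ∀ p ∈ domainΩ n, v p ≤ u p
  v_pos : ∀ p ∈ domainΩ n, 0 < v p
  ut_pos : ∀ p ∈ domainΩ n, 0 < dirDeriv (timeDir n) u p
  u_zero : ∀ y : EuclideanSpace ℝ (Fin n), ‖y‖ < 1 → u (pt 0 y) = 0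
  main : MainCondition u v

namespace Admissible

variable {n : ℕ} {u v : SpaceTime n → ℝ}

lemma strictMonoOn (H : Admissible u v) {y : EuclideanSpace ℝ (Fin n)} (hy : ‖y‖ < 1) :
    StrictMonoOn (fun t => u (pt t y)) (Icc 0 1) := by
  refine strictMonoOn_of_deriv_pos (convex_Icc _ _)
    (fun t ht => (hasDerivWithinAt_time H.smooth_u hy.le ht).continuousWithinAt) fun t ht => ?_
  rw [interior_Icc] at ht
  rw [((hasDerivWithinAt_time H.smooth_u hy.le ⟨ht.1.le, ht.2.le⟩).hasDerivAt
    (Icc_mem_nhds ht.1 ht.2)).deriv]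
  exact H.ut_pos _ ⟨ht.1, ht.2, hy⟩

lemma exists_level (H : Admissible u v) {p : SpaceTime n} (hp : p ∈ domainΩ n) :
    ∃ t ∈ Ioc 0 p.fst, u (pt t p.snd) = v p := by
  have hcont : ContinuousOn (fun t => u (pt t p.snd)) (Icc 0 p.fst) := fun t ht =>
    ((hasDerivWithinAt_time H.smooth_u hp.2.2.le
      ⟨ht.1, ht.2.trans hp.2.1.le⟩).continuousWithinAt).mono (Icc_subset_Icc_right hp.2.1.le)
  have h0 : u (pt 0 p.snd) = 0 := H.u_zero _ hp.2.2
  obtain ⟨t, ht, h⟩ := intermediate_value_Ioc hp.1.le hcont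
    (show v p ∈ Ioc (u (pt 0 p.snd)) (u (pt p.fst p.snd)) from
      ⟨by rw [h0]; exact H.v_pos p hp, H.le p hp⟩)
  exact ⟨t, ht, h⟩

end Admissible

/-- The orthonormal basis of space-time made of the coordinate directions. -/
noncomputable def coordBasis (n : ℕ) : OrthonormalBasis (Unit ⊕ Fin n) ℝ (SpaceTime n) :=
  (OrthonormalBasis.singleton Unit ℝ).prod (EuclideanSpace.basisFun (Fin n) ℝ)

/-- The second derivative test along one line, for the graph of `u` moved in time by a quadratic
polynomial and touching the graph of `v` from above. -/
lemma touching_line {n : ℕ} {u v : SpaceTime n → ℝ}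
    (hu : ContDiffOn ℝ ∞ u (closure (domainΩ n))) (hv : ContDiffOn ℝ ∞ v (closure (domainΩ n)))
    {p q : SpaceTime n} (hp : p ∈ domainΩ n) (hq : q ∈ domainΩ n) (heq : u q = v p)
    (e : SpaceTime n) (a b : ℝ)
    (htouch : ∀ᶠ h in 𝓝 (0 : ℝ),
      v (p + h • e) ≤ u (q + (h • e - (a * h + b * h ^ 2) • timeDir n))) :
    dirDeriv e (dirDeriv e v) p ≤ dirDeriv e (dirDeriv e u) q
      - 2 * a * dirDeriv e (dirDeriv (timeDir n) u) q
      + a ^ 2 * dirDeriv (timeDir n) (dirDeriv (timeDir n) u) q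
      - 2 * b * dirDeriv (timeDir n) u q := by
  set d := timeDir n
  let γ : ℝ → SpaceTime n := fun h => q + (h • e - (a * h + b * h ^ 2) • d)
  let γ' : ℝ → SpaceTime n := fun h => e - (a + 2 * b * h) • d
  let ℓ : ℝ → SpaceTime n := fun h => p + h • e
  have hγ : ∀ h, HasDerivAt γ (γ' h) h := fun h => by
    have h1 : HasDerivAt (fun h : ℝ => a * h + b * h ^ 2) (a + 2 * b * h) h := by
      have := ((hasDerivAt_id h).const_mul a).add (((hasDerivAt_id h).pow 2).const_mul b)
      refine this.congr_deriv ?_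
      simp; ring
    have h2 := ((hasDerivAt_id h).smul_const e).sub (h1.smul_const d) |>.const_add q
    exact h2.congr_deriv (by simp [γ'])
  have hℓ : ∀ h, HasDerivAt ℓ e h := fun h => by
    exact (((hasDerivAt_id h).smul_const e).const_add p).congr_deriv (by simp)
  have hγ0 : γ 0 = q := by simp [γ]
  have hℓ0 : ℓ 0 = p := by simp [ℓ]
  have hγΩ : ∀ᶠ h in 𝓝 (0 : ℝ), γ h ∈ domainΩ n :=
    (hγ 0).continuousAt.eventually_mem (by rw [hγ0]; exact (isOpen_domainΩ n).mem_nhds hq)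
  have hℓΩ : ∀ᶠ h in 𝓝 (0 : ℝ), ℓ h ∈ domainΩ n :=
    (hℓ 0).continuousAt.eventually_mem (by rw [hℓ0]; exact (isOpen_domainΩ n).mem_nhds hp)
  have hmin : IsLocalMin (fun h => u (γ h) - v (ℓ h)) 0 := by
    filter_upwards [htouch] with h hh
    rw [hγ0, hℓ0, heq, sub_self]
    exact sub_nonneg.2 hh
  have hd : ∀ᶠ h in 𝓝 (0 : ℝ), HasDerivAt (fun h => u (γ h) - v (ℓ h))
      (fderiv ℝ u (γ h) (γ' h) - fderiv ℝ v (ℓ h) e) h := by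
    filter_upwards [hγΩ, hℓΩ] with h h1 h2
    exact ((hasFDerivAt_of_mem hu h1).comp_hasDerivAt h (hγ h)).sub
      ((hasFDerivAt_of_mem hv h2).comp_hasDerivAt h (hℓ h))
  have hγ'0 : HasDerivAt γ' (-((2 * b) • d)) 0 := by
    have h1 : HasDerivAt (fun h : ℝ => a + 2 * b * h) (2 * b) 0 := by
      simpa using ((hasDerivAt_id (0 : ℝ)).const_mul (2 * b)).const_add a
    exact (h1.smul_const d).const_sub e
  have hdd : HasDerivAt (fun h => fderiv ℝ u (γ h) (γ' h) - fderiv ℝ v (ℓ h) e)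
      (fderiv ℝ (fderiv ℝ u) q (e - a • d) (e - a • d) + fderiv ℝ u q (-((2 * b) • d))
        - fderiv ℝ (fderiv ℝ v) p e e) 0 := by
    have hu2 := hasFDerivAt_fderiv hu hq
    have hv2 := hasFDerivAt_fderiv hv hp
    rw [← hγ0] at hu2
    rw [← hℓ0] at hv2
    have h1 := (hu2.comp_hasDerivAt 0 (hγ 0)).clm_apply hγ'0
    have h2 := (hv2.comp_hasDerivAt 0 (hℓ 0)).clm_apply (hasDerivAt_const 0 e)
    have h3 := h1.sub h2
    refine h3.congr_deriv ?_
    simp [hγ0, hℓ0, γ']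
  have key := hmin.second_deriv_nonneg hd hdd
  have hsymm : fderiv ℝ (fderiv ℝ u) q d e = fderiv ℝ (fderiv ℝ u) q e d :=
    ((hu.contDiffAt (closure_mem_nhds hq)).isSymmSndFDerivAt (by simpa using two_le_infty)) d e
  simp only [map_sub, map_smul, sub_apply, smul_apply, smul_eq_mul, hsymm,
    fderiv_fderiv_eq_dirDeriv hu hq, fderiv_fderiv_eq_dirDeriv hv hp,
    ← dirDeriv_eq_fderiv hq, dirDeriv_neg_dir, dirDeriv_smul_dir] at key
  linarith

/-- If the graph of `u`, moved in time by a quadratic polynomial with gradient `g`, touches the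
graph of `v` from above, and the Laplacians are ordered as in the main condition, then the
polynomial cannot be a strict subsolution of the elliptic inequality satisfied by the time
shift between `u` and `v`. -/
lemma touching_le {n : ℕ} {u v : SpaceTime n → ℝ}
    (hu : ContDiffOn ℝ ∞ u (closure (domainΩ n))) (hv : ContDiffOn ℝ ∞ v (closure (domainΩ n)))
    {p q : SpaceTime n} (hp : p ∈ domainΩ n) (hq : q ∈ domainΩ n) (heq : u q = v p)
    (hlap : (Δ u) q ≤ (Δ v) p) (g ν : SpaceTime n) (hν : ‖ν‖ = 1) (B A : ℝ)
    (htouch : ∀ᶠ x in 𝓝 (0 : SpaceTime n), v (p + x) ≤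
      u (q + (x - (inner ℝ g x + B * inner ℝ ν x ^ 2 - A * ‖x‖ ^ 2) • timeDir n))) :
    2 * (B - A * (n + 1)) * dirDeriv (timeDir n) u q + 2 * dirDeriv g (dirDeriv (timeDir n) u) q
      - ‖g‖ ^ 2 * dirDeriv (timeDir n) (dirDeriv (timeDir n) u) q ≤ 0 := by
  have hline : ∀ i, dirDeriv (coordBasis n i) (dirDeriv (coordBasis n i) v) p ≤
      dirDeriv (coordBasis n i) (dirDeriv (coordBasis n i) u) q
      - 2 * inner ℝ g (coordBasis n i) * dirDeriv (coordBasis n i) (dirDeriv (timeDir n) u) q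
      + inner ℝ g (coordBasis n i) ^ 2 * dirDeriv (timeDir n) (dirDeriv (timeDir n) u) q
      - 2 * (B * inner ℝ ν (coordBasis n i) ^ 2 - A) * dirDeriv (timeDir n) u q := fun i => by
    refine touching_line hu hv hp hq heq _ _ _ ?_
    have hlim : Tendsto (fun h : ℝ => h • coordBasis n i) (𝓝 0) (𝓝 0) := by
      have : Continuous fun h : ℝ => h • coordBasis n i := by fun_prop
      simpa using this.tendsto 0
    filter_upwards [hlim.eventually htouch] with h hh
    have e1 : inner ℝ g (coordBasis n i) * h + (B * inner ℝ ν (coordBasis n i) ^ 2 - A) * h ^ 2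
        = inner ℝ g (h • coordBasis n i) + B * inner ℝ ν (h • coordBasis n i) ^ 2
          - A * ‖h • coordBasis n i‖ ^ 2 := by
      rw [inner_smul_right, inner_smul_right, norm_smul, (coordBasis n).norm_eq_one,
        Real.norm_eq_abs, mul_one, sq_abs]
      ring
    rw [e1]
    exact hh
  have hsum := Finset.sum_le_sum fun i (_ : i ∈ Finset.univ) => hline i
  rw [← laplacian_eq_sum hv hp] at hsum
  simp only [Finset.sum_sub_distrib, Finset.sum_add_distrib] at hsum
  rw [← laplacian_eq_sum hu hq] at hsum
  have h1 : ∑ i, 2 * inner ℝ g (coordBasis n i) *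
      dirDeriv (coordBasis n i) (dirDeriv (timeDir n) u) q
      = 2 * dirDeriv g (dirDeriv (timeDir n) u) q := by
    conv_rhs => rw [← (coordBasis n).sum_repr' g]
    simp only [dirDeriv, map_sum, map_smul, smul_eq_mul, Finset.mul_sum]
    exact Finset.sum_congr rfl fun i _ => by rw [real_inner_comm]; ring
  have h2 : ∀ x : SpaceTime n, ∑ i, inner ℝ x (coordBasis n i) ^ 2 = ‖x‖ ^ 2 := fun x => by
    have := (coordBasis n).sum_sq_norm_inner_left x
    simpa using this
  have h3 : ∑ i, 2 * (B * inner ℝ ν (coordBasis n i) ^ 2 - A) * dirDeriv (timeDir n) u q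
      = 2 * (B - A * (n + 1)) * dirDeriv (timeDir n) u q := by
    have hA : ∑ _i : Unit ⊕ Fin n, A = (n + 1) * A := by simp [add_comm]
    rw [← Finset.sum_mul, ← Finset.mul_sum, Finset.sum_sub_distrib, ← Finset.mul_sum, h2, hν, hA]
    ring
  rw [h1, ← Finset.sum_mul, h2, h3] at hsum
  linarith

/-! ### Comparison of the time shift with quadratic barriers -/

/-- The quadratic barrier `ε (ℓ + B ℓ² - A |p - z|²)`, where `ℓ = ⟪ν, p - z⟫`. It vanishes at `z`
and is positive on a region that touches the hyperplane `ℓ = 0` only at `z`. -/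
noncomputable def barrier {n : ℕ} (z ν : SpaceTime n) (ε B A : ℝ) (p : SpaceTime n) : ℝ :=
  ε * (inner ℝ ν (p - z) + B * inner ℝ ν (p - z) ^ 2 - A * ‖p - z‖ ^ 2)

/-- The gradient of `barrier`. -/
noncomputable def barrierGrad {n : ℕ} (z ν : SpaceTime n) (ε B A : ℝ) (p : SpaceTime n) :
    SpaceTime n :=
  ε • ((1 + 2 * B * inner ℝ ν (p - z)) • ν - (2 * A) • (p - z))

lemma barrier_add {n : ℕ} (z ν : SpaceTime n) (ε B A : ℝ) (p x : SpaceTime n) :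
    barrier z ν ε B A (p + x) = barrier z ν ε B A p +
      (inner ℝ (barrierGrad z ν ε B A p) x + ε * B * inner ℝ ν x ^ 2 - ε * A * ‖x‖ ^ 2) := by
  have h : p + x - z = (p - z) + x := by abel
  simp only [barrier, barrierGrad, h, inner_add_right, norm_add_sq_real, inner_smul_left,
    inner_sub_left]
  simp
  ring

@[fun_prop] lemma continuous_barrier {n : ℕ} (z ν : SpaceTime n) (ε B A : ℝ) :
    Continuous (barrier z ν ε B A) := by
  unfold barrier; fun_prop

namespace Admissible

variable {n : ℕ} {u v : SpaceTime n → ℝ}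

/-- The level condition `u (t, y) = v (s, y)`, `0 ≤ t ≤ s`, is a compact condition over a compact
set of points `(s, y)`. -/
lemma isCompact_levels (H : Admissible u v) {K : Set (SpaceTime n)} (hK : IsCompact K)
    (hsub : K ⊆ closure (domainΩ n)) :
    IsCompact {x : ℝ × SpaceTime n | x.2 ∈ K ∧ 0 ≤ x.1 ∧ x.1 ≤ x.2.fst ∧
      u (pt x.1 x.2.snd) = v x.2} := by
  set K₀ : Set (ℝ × SpaceTime n) := {x | x.2 ∈ K ∧ 0 ≤ x.1 ∧ x.1 ≤ x.2.fst}
  have hclosed : IsClosed K₀ :=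
    (hK.isClosed.preimage continuous_snd).inter
      ((isClosed_le continuous_const continuous_fst).inter
        (isClosed_le continuous_fst (continuous_fst'.comp continuous_snd)))
  have hK₀ : IsCompact K₀ := by
    refine (isCompact_Icc.prod hK : IsCompact (Icc (0 : ℝ) 1 ×ˢ K)).of_isClosed_subset hclosed ?_
    rintro ⟨t, p⟩ ⟨hp, h0, h1⟩
    exact ⟨⟨h0, h1.trans (mem_closure_domainΩ.1 (hsub hp)).2.1⟩, hp⟩
  have hcont : ContinuousOn (fun x : ℝ × SpaceTime n => u (pt x.1 x.2.snd) - v x.2) K₀ := by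
    refine ContinuousOn.sub ?_ ?_
    · refine H.smooth_u.continuousOn.comp (f := fun x : ℝ × SpaceTime n => pt x.1 x.2.snd)
        (by fun_prop) ?_
      rintro ⟨t, p⟩ ⟨hp, h0, h1⟩
      obtain ⟨h2, h3, h4⟩ := mem_closure_domainΩ.1 (hsub hp)
      exact pt_mem_closure h0 (h1.trans h3) h4
    · exact H.smooth_v.continuousOn.comp continuousOn_snd fun x hx => hsub hx.1
  have hc := hcont.preimage_isClosed_of_isClosed hclosed (isClosed_singleton (x := (0 : ℝ)))
  convert hK₀.of_isClosed_subset hc inter_subset_left using 1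
  ext x
  simp [K₀, sub_eq_zero, and_assoc]

/-- Over a compact set on which `v < u`, the time shift is bounded below by a positive constant. -/
lemma exists_shift_bound (H : Admissible u v) {K : Set (SpaceTime n)} (hK : IsCompact K)
    (hsub : K ⊆ domainΩ n) (hlt : ∀ p ∈ K, v p < u p) :
    ∃ c > 0, ∀ p ∈ K, ∀ t, 0 ≤ t → t ≤ p.fst → u (pt t p.snd) = v p → c ≤ p.fst - t := by
  have hc := H.isCompact_levels hK (hsub.trans subset_closure)
  set L := {x : ℝ × SpaceTime n | x.2 ∈ K ∧ 0 ≤ x.1 ∧ x.1 ≤ x.2.fst ∧ u (pt x.1 x.2.snd) = v x.2}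
  rcases L.eq_empty_or_nonempty with he | hne
  · refine ⟨1, one_pos, fun p hp t h0 h1 h2 => ?_⟩
    have hmem : (t, p) ∈ L := ⟨hp, h0, h1, h2⟩
    rw [he] at hmem
    exact absurd hmem (notMem_empty _)
  · obtain ⟨x, hx, hmin⟩ := hc.exists_isMinOn hne
      (f := fun x : ℝ × SpaceTime n => x.2.fst - x.1) (by fun_prop)
    refine ⟨x.2.fst - x.1, ?_, fun p hp t h0 h1 h2 =>
      hmin (show (t, p) ∈ L from ⟨hp, h0, h1, h2⟩)⟩
    obtain ⟨hx1, -, hx3, hx4⟩ := hx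
    rcases hx3.eq_or_lt with h | h
    · rw [h, pt_eta] at hx4
      exact absurd hx4 (hlt _ hx1).ne'
    · exact sub_pos.2 h

/-- **Comparison principle.** A quadratic barrier that is a strict subsolution of the inequality
for the time shift `s - t`, where `u (t, y) = v (s, y)`, and that lies below the time shift on the
cap `ℓ = h` of the region where it is positive, lies below the time shift on the whole region. -/
theorem barrier_le (H : Admissible u v) {z ν : SpaceTime n} (hν : ‖ν‖ = 1) {ε B A h : ℝ}
    (hε : 0 ≤ ε) (hA : 0 ≤ A)
    (hreg : ∀ p, 0 ≤ inner ℝ ν (p - z) → inner ℝ ν (p - z) ≤ h → 0 ≤ barrier z ν ε B A p →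
      0 ≤ p.fst ∧ p.fst < 1 ∧ ‖p.snd‖ < 1)
    (hreg' : ∀ p, 0 < inner ℝ ν (p - z) → inner ℝ ν (p - z) < h → 0 < barrier z ν ε B A p →
      0 < p.fst)
    (htop : ∀ p, inner ℝ ν (p - z) = h → 0 ≤ barrier z ν ε B A p → ∀ t, 0 ≤ t → t ≤ p.fst →
      u (pt t p.snd) = v p → barrier z ν ε B A p ≤ p.fst - t)
    (hstrict : ∀ p, 0 < inner ℝ ν (p - z) → inner ℝ ν (p - z) < h → 0 < barrier z ν ε B A p →
      ∀ t, 0 < t → t ≤ p.fst → p.fst - t < barrier z ν ε B A p →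
      0 < 2 * (ε * B - ε * A * (n + 1)) * dirDeriv (timeDir n) u (pt t p.snd)
        + 2 * dirDeriv (barrierGrad z ν ε B A p) (dirDeriv (timeDir n) u) (pt t p.snd)
        - ‖barrierGrad z ν ε B A p‖ ^ 2 *
          dirDeriv (timeDir n) (dirDeriv (timeDir n) u) (pt t p.snd)) :
    ∀ p, 0 ≤ inner ℝ ν (p - z) → inner ℝ ν (p - z) ≤ h → ∀ t, 0 ≤ t → t ≤ p.fst →
      u (pt t p.snd) = v p → barrier z ν ε B A p ≤ p.fst - t := by
  intro p hp0 hph t ht0 hts hlev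
  by_contra! hlt
  set φ := barrier z ν ε B A with hφ
  have hcφ : Continuous φ := continuous_barrier z ν ε B A
  set K : Set (SpaceTime n) := {p | 0 ≤ inner ℝ ν (p - z) ∧ inner ℝ ν (p - z) ≤ h ∧ 0 ≤ φ p}
  have hKsub : K ⊆ closure (domainΩ n) := fun p hp => by
    obtain ⟨h1, h2, h3⟩ := hreg p hp.1 hp.2.1 hp.2.2
    exact mem_closure_domainΩ.2 ⟨h1, h2.le, h3.le⟩
  have hKc : IsCompact K := by
    refine (isCompact_closure_domainΩ n).of_isClosed_subset ?_ hKsub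
    have hcl : Continuous fun p : SpaceTime n => inner ℝ ν (p - z) := by fun_prop
    exact (isClosed_le continuous_const hcl).inter
      ((isClosed_le hcl continuous_const).inter (isClosed_le continuous_const hcφ))
  have hpK : p ∈ K := ⟨hp0, hph, by linarith⟩
  obtain ⟨⟨t₀, p₀⟩, ⟨hp₀K, ht₀, hts₀, hlev₀⟩, hmin⟩ :=
    (H.isCompact_levels hKc hKsub).exists_isMinOn ⟨(t, p), hpK, ht0, hts, hlev⟩
      (f := fun x : ℝ × SpaceTime n => x.2.fst - x.1 - φ x.2) (by fun_prop)
  simp only at hp₀K ht₀ hts₀ hlev₀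
  have hneg : p₀.fst - t₀ < φ p₀ := by
    have := hmin (show (t, p) ∈ _ from ⟨hpK, ht0, hts, hlev⟩)
    simp only [mem_ofPred_eq] at this
    linarith
  have hφpos : 0 < φ p₀ := by linarith
  -- the minimum lies neither on the cap nor at the vertex of the region
  have hltop : inner ℝ ν (p₀ - z) < h := by
    refine lt_of_le_of_ne hp₀K.2.1 fun he => ?_
    exact absurd (htop p₀ he hφpos.le t₀ ht₀ hts₀ hlev₀) (not_le.2 hneg)
  have hl0 : 0 < inner ℝ ν (p₀ - z) := by
    refine lt_of_le_of_ne hp₀K.1 fun he => ?_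
    have : φ p₀ ≤ 0 := by
      rw [hφ, barrier, ← he]
      have : 0 ≤ A * ‖p₀ - z‖ ^ 2 := by positivity
      nlinarith
    linarith
  have hs0 := hreg' p₀ hl0 hltop hφpos
  obtain ⟨-, hs1, hy1⟩ := hreg p₀ hl0.le hltop.le hφpos.le
  have hp₀Ω : p₀ ∈ domainΩ n := ⟨hs0, hs1, hy1⟩
  have ht₀pos : 0 < t₀ := by
    refine lt_of_le_of_ne ht₀ fun he => ?_
    rw [← he, H.u_zero _ hy1] at hlev₀
    exact (H.v_pos _ hp₀Ω).ne hlev₀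
  have hqΩ : pt t₀ p₀.snd ∈ domainΩ n := ⟨ht₀pos, hts₀.trans_lt hs1, hy1⟩
  have hlap : (Δ u) (pt t₀ p₀.snd) ≤ (Δ v) p₀ :=
    H.main t₀ p₀.fst p₀.snd ht₀pos hts₀ hs1 hy1 hlev₀
  have htouch : ∀ᶠ x in 𝓝 (0 : SpaceTime n), v (p₀ + x) ≤
      u (pt t₀ p₀.snd + (x - (inner ℝ (barrierGrad z ν ε B A p₀) x + ε * B * inner ℝ ν x ^ 2
        - ε * A * ‖x‖ ^ 2) • timeDir n)) := by
    have hc : Continuous fun x : SpaceTime n => p₀ + x := by fun_prop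
    have e1 : ∀ᶠ x in 𝓝 (0 : SpaceTime n), p₀ + x ∈ domainΩ n :=
      hc.continuousAt.eventually_mem (by simpa using (isOpen_domainΩ n).mem_nhds hp₀Ω)
    have e2 : ∀ᶠ x in 𝓝 (0 : SpaceTime n), 0 < φ (p₀ + x) :=
      (hcφ.comp hc).continuousAt.eventually_mem (s := Ioi 0)
        (by simpa using Ioi_mem_nhds hφpos)
    have hcl : Continuous fun x : SpaceTime n => inner ℝ ν (p₀ + x - z) := by fun_prop
    have e3 : ∀ᶠ x in 𝓝 (0 : SpaceTime n), inner ℝ ν (p₀ + x - z) ∈ Ioo 0 h :=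
      hcl.continuousAt.eventually_mem (by simpa using Ioo_mem_nhds hl0 hltop)
    have hct : Continuous fun x : SpaceTime n => t₀ + (x.fst - (φ (p₀ + x) - φ p₀)) := by fun_prop
    have e4 : ∀ᶠ x in 𝓝 (0 : SpaceTime n), t₀ + (x.fst - (φ (p₀ + x) - φ p₀)) ∈ Ioo (0 : ℝ) 1 :=
      hct.continuousAt.eventually_mem (by simpa using Ioo_mem_nhds ht₀pos (hts₀.trans_lt hs1))
    filter_upwards [e1, e2, e3, e4] with x h1 h2 h3 h4
    obtain ⟨t', ht', hlev'⟩ := H.exists_level h1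
    have hK' : p₀ + x ∈ K := ⟨h3.1.le, h3.2.le, h2.le⟩
    have hm := hmin (show (t', p₀ + x) ∈ _ from ⟨hK', ht'.1.le, ht'.2, hlev'⟩)
    simp only [mem_ofPred_eq] at hm
    have hfst : (p₀ + x).fst = p₀.fst + x.fst := rfl
    have hle : t' ≤ t₀ + (x.fst - (φ (p₀ + x) - φ p₀)) := by rw [hfst] at hm; linarith
    have hq : pt t₀ p₀.snd + (x - (inner ℝ (barrierGrad z ν ε B A p₀) x
        + ε * B * inner ℝ ν x ^ 2 - ε * A * ‖x‖ ^ 2) • timeDir n)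
        = pt (t₀ + (x.fst - (φ (p₀ + x) - φ p₀))) (p₀ + x).snd := by
      rw [hφ, barrier_add]
      rw [show x = pt x.fst x.snd from rfl, timeDir, smul_pt, pt_sub, pt_add]
      congr 1
      · simp
      · simp
    rw [hq, ← hlev']
    exact (H.strictMonoOn h1.2.2).monotoneOn ⟨ht'.1.le, ht'.2.trans h1.2.1.le⟩
      ⟨h4.1.le, h4.2.le⟩ hle
  have h1 := touching_le H.smooth_u H.smooth_v hp₀Ω hqΩ hlev₀ hlap _ ν hν _ _ htouch
  have h2 := hstrict p₀ hl0 hltop hφpos t₀ ht₀pos hts₀ hneg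
  linarith

end Admissible

/-! ### The strong maximum principle -/

lemma norm_barrierGrad_le {n : ℕ} {z ν : SpaceTime n} (hν : ‖ν‖ = 1) {ε B A : ℝ} (hε : 0 ≤ ε)
    (hA : 0 ≤ A) (p : SpaceTime n) :
    ‖barrierGrad z ν ε B A p‖ ≤ ε * (|1 + 2 * B * inner ℝ ν (p - z)| + 2 * A * ‖p - z‖) := by
  rw [barrierGrad, norm_smul, Real.norm_of_nonneg hε]
  gcongr
  refine (norm_sub_le _ _).trans (le_of_eq ?_)
  rw [norm_smul, norm_smul, hν, mul_one, Real.norm_eq_abs, Real.norm_of_nonneg (by positivity)]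

lemma exists_dirDeriv_bound {n : ℕ} {w : SpaceTime n → ℝ}
    (hw : ContDiffOn ℝ ∞ w (closure (domainΩ n))) :
    ∃ M, 0 ≤ M ∧ ∀ p ∈ closure (domainΩ n), ∀ e, |dirDeriv e w p| ≤ M * ‖e‖ := by
  have hc : ContinuousOn (fderivWithin ℝ w (closure (domainΩ n))) (closure (domainΩ n)) :=
    hw.continuousOn_fderivWithin (uniqueDiffOn_closure_domainΩ n) (by simp)
  obtain ⟨C, hC⟩ := (isCompact_closure_domainΩ n).exists_bound_of_continuousOn hc
  refine ⟨max C 0, le_max_right _ _, fun p hp e => ?_⟩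
  exact (ContinuousLinearMap.le_opNorm _ e).trans
    (mul_le_mul_of_nonneg_right ((hC p hp).trans (le_max_left _ _)) (norm_nonneg e))

namespace Admissible

variable {n : ℕ} {u v : SpaceTime n → ℝ}

set_option maxHeartbeats 1000000 in
/-- The form of the Hopf lemma behind the strong maximum principle: a ball in `Ω` on which `v < u`
has no boundary point in `Ω` at which `u = v`. -/
lemma not_touching (H : Admissible u v) {z c : SpaceTime n} (hz : z ∈ domainΩ n)
    (hzv : u z = v z) (hzc : 0 < ‖c - z‖)
    (hlt : ∀ p ∈ Metric.ball c ‖c - z‖, p ∈ domainΩ n → v p < u p) : False := by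
  set R := ‖c - z‖ with hR
  set ν : SpaceTime n := R⁻¹ • (c - z) with hνdef
  have hν : ‖ν‖ = 1 := by
    rw [hνdef, norm_smul, norm_inv, Real.norm_of_nonneg hzc.le, ← hR, inv_mul_cancel₀ hzc.ne']
  have hcz : c - z = R • ν := by rw [hνdef, smul_smul, mul_inv_cancel₀ hzc.ne', one_smul]
  obtain ⟨r₀, hr₀, hball₀⟩ := Metric.nhds_basis_closedBall.mem_iff.1
    ((isOpen_domainΩ n).mem_nhds hz)
  set r := min r₀ R with hr
  have hrpos : 0 < r := lt_min hr₀ hzc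
  have hrR : r ≤ R := min_le_right _ _
  have hball : Metric.closedBall z r ⊆ domainΩ n :=
    (Metric.closedBall_subset_closedBall (min_le_left _ _)).trans hball₀
  have hut := contDiffOn_dirDeriv H.smooth_u (timeDir n)
  -- lower bound for `∂ₜ u` near `z` and upper bounds for its derivatives
  obtain ⟨m, hm, hmle⟩ : ∃ m > 0, ∀ q ∈ Metric.closedBall z r, m ≤ dirDeriv (timeDir n) u q := by
    obtain ⟨q, hq, hmin⟩ := (isCompact_closedBall z r).exists_isMinOn
      ⟨z, Metric.mem_closedBall_self hrpos.le⟩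
      (hut.continuousOn.mono (hball.trans subset_closure))
    exact ⟨_, H.ut_pos q (hball hq), fun q' hq' => hmin hq'⟩
  obtain ⟨M, hM, hMle⟩ := exists_dirDeriv_bound hut
  set A : ℝ := 2 / R with hAdef
  have hA : 0 < A := by positivity
  have hAR : A * R = 2 := by rw [hAdef]; field_simp
  set B : ℝ := A * (n + 1) + (35 * M + 1) / (2 * m) with hB
  have hBA : A ≤ B := by
    have : 0 ≤ A * n + (35 * M + 1) / (2 * m) := by positivity
    rw [hB]; linarith
  have hBpos : 0 < B := hA.trans_le hBA
  set h : ℝ := min (1 / B) (min (r / 4) (r ^ 2 / (4 * R))) with hh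
  have hhpos : 0 < h := by positivity
  have hBh : B * h ≤ 1 := by
    have : h ≤ 1 / B := min_le_left _ _
    rwa [le_div_iff₀ hBpos, mul_comm] at this
  have hhr : h ≤ r / 4 := (min_le_right _ _).trans (min_le_left _ _)
  have hhR : R * h ≤ r ^ 2 / 4 := by
    have : h ≤ r ^ 2 / (4 * R) := (min_le_right _ _).trans (min_le_right _ _)
    rw [le_div_iff₀ (by positivity)] at this
    linarith
  -- size of the region where the barrier is positive
  have hquad : ∀ p : SpaceTime n, 0 ≤ inner ℝ ν (p - z) → inner ℝ ν (p - z) ≤ h →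
      A * ‖p - z‖ ^ 2 ≤ inner ℝ ν (p - z) + B * inner ℝ ν (p - z) ^ 2 →
      ‖p - z‖ ^ 2 ≤ R * inner ℝ ν (p - z) ∧ ‖p - z‖ ≤ r / 2 := by
    intro p h0 h1 h2
    have h3 : B * inner ℝ ν (p - z) ≤ 1 := (mul_le_mul_of_nonneg_left h1 hBpos.le).trans hBh
    have h4 : A * ‖p - z‖ ^ 2 ≤ 2 * inner ℝ ν (p - z) := by nlinarith
    have h5 : ‖p - z‖ ^ 2 ≤ R * inner ℝ ν (p - z) := by
      have h6 := mul_le_mul_of_nonneg_left h4 hzc.le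
      nlinarith
    refine ⟨h5, ?_⟩
    have h6 : ‖p - z‖ ^ 2 ≤ (r / 2) ^ 2 := by
      have := mul_le_mul_of_nonneg_left h1 hzc.le
      nlinarith
    exact (sq_le_sq₀ (norm_nonneg _) (by positivity)).1 h6
  set K : Set (SpaceTime n) := {p | inner ℝ ν (p - z) = h ∧
    A * ‖p - z‖ ^ 2 ≤ inner ℝ ν (p - z) + B * inner ℝ ν (p - z) ^ 2} with hK
  have hKball : K ⊆ Metric.closedBall z r := fun p hp => by
    have := (hquad p (by rw [hp.1]; exact hhpos.le) hp.1.le hp.2).2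
    rw [Metric.mem_closedBall, dist_eq_norm]; linarith
  have hKc : IsCompact K := by
    have hcl : Continuous fun p : SpaceTime n => inner ℝ ν (p - z) := by fun_prop
    exact (isCompact_closedBall z r).of_isClosed_subset
      ((isClosed_eq hcl continuous_const).inter (isClosed_le
        (f := fun p : SpaceTime n => A * ‖p - z‖ ^ 2)
        (g := fun p : SpaceTime n => inner ℝ ν (p - z) + B * inner ℝ ν (p - z) ^ 2)
        (by fun_prop) (by fun_prop))) hKball
  have hKlt : ∀ p ∈ K, v p < u p := fun p hp => by
    refine hlt p ?_ (hball (hKball hp))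
    have h1 := (hquad p (by rw [hp.1]; exact hhpos.le) hp.1.le hp.2).1
    have h2 : p - c = (p - z) - R • ν := by rw [← hcz]; abel
    rw [Metric.mem_ball, dist_eq_norm, ← sq_lt_sq₀ (norm_nonneg _) hzc.le, h2, norm_sub_sq_real,
      norm_smul, hν, real_inner_smul_right, real_inner_comm, Real.norm_of_nonneg hzc.le]
    rw [hp.1] at h1 ⊢
    nlinarith [mul_pos hzc hhpos]
  obtain ⟨c₀, hc₀, hshift⟩ := H.exists_shift_bound hKc (hKball.trans hball) hKlt
  set ε : ℝ := min 1 (c₀ / (2 * h)) with hε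
  have hεpos : 0 < ε := by positivity
  have hε1 : ε ≤ 1 := min_le_left _ _
  have hεc : ε * (2 * h) ≤ c₀ := by
    have : ε ≤ c₀ / (2 * h) := min_le_right _ _
    rwa [le_div_iff₀ (by positivity)] at this
  have hpos_iff : ∀ p, 0 ≤ barrier z ν ε B A p →
      A * ‖p - z‖ ^ 2 ≤ inner ℝ ν (p - z) + B * inner ℝ ν (p - z) ^ 2 := fun p hp => by
    have := nonneg_of_mul_nonneg_right hp hεpos
    linarith
  have hφle : ∀ p, 0 ≤ inner ℝ ν (p - z) → inner ℝ ν (p - z) ≤ h →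
      barrier z ν ε B A p ≤ ε * (2 * h) := fun p h0 h1 => by
    rw [barrier]
    gcongr
    have h3 : B * inner ℝ ν (p - z) ≤ 1 := (mul_le_mul_of_nonneg_left h1 hBpos.le).trans hBh
    have h4 : 0 ≤ A * ‖p - z‖ ^ 2 := by positivity
    nlinarith
  have hstrict : ∀ p, 0 < inner ℝ ν (p - z) → inner ℝ ν (p - z) < h → 0 < barrier z ν ε B A p →
      ∀ t, 0 < t → t ≤ p.fst → p.fst - t < barrier z ν ε B A p →
      0 < 2 * (ε * B - ε * A * (n + 1)) * dirDeriv (timeDir n) u (pt t p.snd)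
        + 2 * dirDeriv (barrierGrad z ν ε B A p) (dirDeriv (timeDir n) u) (pt t p.snd)
        - ‖barrierGrad z ν ε B A p‖ ^ 2 *
          dirDeriv (timeDir n) (dirDeriv (timeDir n) u) (pt t p.snd) := by
    intro p h0 h1 h2 t ht hts htφ
    have hpz := (hquad p h0.le h1.le (hpos_iff p h2.le)).2
    have hqball : pt t p.snd ∈ Metric.closedBall z r := by
      rw [Metric.mem_closedBall, dist_eq_norm]
      have e1 : pt t p.snd - z = (p - z) - (p.fst - t) • timeDir n := by
        have : pt t p.snd = p - (p.fst - t) • timeDir n := by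
          conv_rhs => rw [← pt_eta p, timeDir, smul_pt, pt_sub]
          congr 1 <;> simp
        rw [this]; abel
      rw [e1]
      refine (norm_sub_le _ _).trans ?_
      rw [norm_smul, norm_timeDir, mul_one, Real.norm_of_nonneg (by linarith)]
      have := hφle p h0.le h1.le
      nlinarith
    have hqcl := subset_closure (hball hqball)
    have hg : ‖barrierGrad z ν ε B A p‖ ≤ 5 * ε := by
      refine (norm_barrierGrad_le hν hεpos.le hA.le p).trans ?_
      have h3 : B * inner ℝ ν (p - z) ≤ 1 := (mul_le_mul_of_nonneg_left h1.le hBpos.le).trans hBh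
      have h4 : 0 ≤ B * inner ℝ ν (p - z) := by positivity
      rw [abs_of_nonneg (by linarith)]
      have h5 : A * ‖p - z‖ ≤ 1 := by
        calc A * ‖p - z‖ ≤ A * (R / 2) := by gcongr; linarith
          _ = 1 := by linarith
      nlinarith
    have h3 := hmle _ hqball
    have h4 := (abs_le.1 (hMle _ hqcl (barrierGrad z ν ε B A p))).1
    have h5 := (abs_le.1 (hMle _ hqcl (timeDir n))).2
    rw [norm_timeDir, mul_one] at h5
    have h6 : M * ‖barrierGrad z ν ε B A p‖ ≤ M * (5 * ε) := by gcongr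
    have h7 : ‖barrierGrad z ν ε B A p‖ ^ 2 *
        dirDeriv (timeDir n) (dirDeriv (timeDir n) u) (pt t p.snd) ≤ 25 * ε * M := by
      calc _ ≤ ‖barrierGrad z ν ε B A p‖ ^ 2 * M := by gcongr
        _ ≤ (5 * ε) ^ 2 * M := by gcongr
        _ ≤ 25 * ε * M := by
          have := mul_le_mul_of_nonneg_left hε1 (mul_nonneg hεpos.le hM)
          linarith
    have h8 : ε * (35 * M + 1) ≤ 2 * (ε * B - ε * A * (n + 1)) *
        dirDeriv (timeDir n) u (pt t p.snd) := by
      have e : 2 * (ε * B - ε * A * (n + 1)) = ε * (35 * M + 1) / m := by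
        rw [hB]; field_simp; ring
      rw [e, div_mul_eq_mul_div, le_div_iff₀ hm]
      gcongr
    nlinarith
  have hmain := H.barrier_le (z := z) hν (ε := ε) (B := B) (A := A) (h := h) hεpos.le hA.le
    (fun p h0 h1 h2 => by
      have := (hquad p h0 h1 (hpos_iff p h2)).2
      have hp : p ∈ domainΩ n := hball (by rw [Metric.mem_closedBall, dist_eq_norm]; linarith)
      exact ⟨hp.1.le, hp.2⟩)
    (fun p h0 h1 h2 => by
      have := (hquad p h0.le h1.le (hpos_iff p h2.le)).2
      have hp : p ∈ domainΩ n := hball (by rw [Metric.mem_closedBall, dist_eq_norm]; linarith)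
      exact hp.1)
    (fun p h0 h1 t h2 h3 h4 =>
      ((hφle p (h0 ▸ hhpos.le) h0.le).trans hεc).trans (hshift p ⟨h0, hpos_iff p h1⟩ t h2 h3 h4))
    hstrict
  -- the barrier forces `u - v` to grow linearly at `z`, where its gradient vanishes
  have hψ : HasDerivAt (fun x : ℝ => u (z + x • (ν - ε • timeDir n)) - v (z + x • ν))
      (-(ε * dirDeriv (timeDir n) u z)) 0 := by
    have hgrad : fderiv ℝ u z = fderiv ℝ v z := by
      have hmin : IsLocalMin (fun p => u p - v p) z := by
        filter_upwards [(isOpen_domainΩ n).mem_nhds hz] with p hp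
        rw [hzv, sub_self]
        exact sub_nonneg.2 (H.le p hp)
      have := hmin.hasFDerivAt_eq_zero
        ((hasFDerivAt_of_mem H.smooth_u hz).sub (hasFDerivAt_of_mem H.smooth_v hz))
      exact sub_eq_zero.1 this
    have hl : ∀ e : SpaceTime n, HasDerivAt (fun x : ℝ => z + x • e) e 0 := fun e =>
      (((hasDerivAt_id (0 : ℝ)).smul_const e).const_add z).congr_deriv (by simp)
    have h1 := hasFDerivAt_of_mem H.smooth_u hz
    have h2 := hasFDerivAt_of_mem H.smooth_v hz
    have e0 : ∀ e : SpaceTime n, z = z + (0 : ℝ) • e := fun e => by simp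
    have h3 := HasFDerivAt.comp_hasDerivAt (0 : ℝ) (by rw [← e0]; exact h1)
      (hl (ν - ε • timeDir n))
    have h4 := HasFDerivAt.comp_hasDerivAt (0 : ℝ) (by rw [← e0]; exact h2) (hl ν)
    refine (h3.sub h4).congr_deriv ?_
    rw [dirDeriv_eq_fderiv hz, hgrad, map_sub, (fderiv ℝ v z).map_smul ε (timeDir n), smul_eq_mul]
    ring
  have hlim := hψ.tendsto_slope_zero_right
  have hnonneg : 0 ≤ -(ε * dirDeriv (timeDir n) u z) := by
    refine ge_of_tendsto hlim ?_
    filter_upwards [Ioo_mem_nhdsGT hhpos] with x hx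
    have hinn : inner ℝ ν (z + x • ν - z) = x := by
      rw [add_sub_cancel_left, real_inner_smul_right, real_inner_self_eq_norm_sq, hν]; ring
    have hnrm : ‖z + x • ν - z‖ = x := by
      rw [add_sub_cancel_left, norm_smul, hν, Real.norm_of_nonneg hx.1.le, mul_one]
    have hpΩ : z + x • ν ∈ domainΩ n := hball (by
      rw [Metric.mem_closedBall, dist_eq_norm, hnrm]; linarith [hx.2])
    obtain ⟨t, ht, hlev⟩ := H.exists_level hpΩ
    have h1 := hmain _ (by rw [hinn]; exact hx.1.le) (by rw [hinn]; exact hx.2.le) t ht.1.le ht.2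
      hlev
    rw [barrier, hinn, hnrm] at h1
    have h2 : ε * x ≤ ε * (x + B * x ^ 2 - A * x ^ 2) := by
      gcongr; nlinarith [sq_nonneg x]
    have h3 : z + x • (ν - ε • timeDir n) = pt ((z + x • ν).fst - ε * x) (z + x • ν).snd := by
      have : z + x • (ν - ε • timeDir n) = (z + x • ν) - (ε * x) • timeDir n := by
        rw [smul_sub, smul_smul x ε, mul_comm x ε]; abel
      rw [this]
      conv_lhs => rw [← pt_eta (z + x • ν), timeDir, smul_pt, pt_sub]
      congr 1 <;> simp
    have h4 : v (z + x • ν) ≤ u (z + x • (ν - ε • timeDir n)) := by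
      rw [h3, ← hlev]
      refine (H.strictMonoOn hpΩ.2.2).monotoneOn ⟨ht.1.le, ht.2.trans hpΩ.2.1.le⟩
        ⟨by linarith [ht.1], ?_⟩ (by linarith)
      have := hpΩ.2.1
      nlinarith [hx.1]
    simp only [zero_add, zero_smul, add_zero, hzv, sub_self, sub_zero, smul_eq_mul]
    exact mul_nonneg (inv_nonneg.2 hx.1.le) (sub_nonneg.2 h4)
  have := mul_pos hεpos (H.ut_pos z hz)
  linarith

/-- **Strong maximum principle.** If `v < u` somewhere in `Ω` then `v < u` throughout `Ω`. -/
theorem lt_of_exists_lt (H : Admissible u v) (hex : ∃ p ∈ domainΩ n, v p < u p) :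
    ∀ p ∈ domainΩ n, v p < u p := by
  have hcu := H.smooth_u.continuousOn.mono (subset_closure (s := domainΩ n))
  have hcv := H.smooth_v.continuousOn.mono (subset_closure (s := domainΩ n))
  set W : Set (SpaceTime n) := {p | p ∈ domainΩ n ∧ v p < u p} with hW
  have hWo : IsOpen W := by
    have := (hcu.sub hcv).isOpen_inter_preimage (isOpen_domainΩ n) (isOpen_Ioi (a := (0 : ℝ)))
    have hWeq : W = domainΩ n ∩ (u - v) ⁻¹' Ioi 0 := by ext p; simp [hW]
    rwa [hWeq]
  have hsub : domainΩ n ⊆ W := by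
    obtain ⟨p, hp, hlt⟩ := hex
    refine (convex_domainΩ n).isPreconnected.subset_of_closure_inter_subset hWo
      ⟨p, hp, hp, hlt⟩ ?_
    rintro z₀ ⟨hz₀W, hz₀⟩
    by_contra hnot
    have hz₀v : u z₀ = v z₀ := by
      refine le_antisymm ?_ (H.le _ hz₀)
      by_contra! h
      exact hnot ⟨hz₀, h⟩
    obtain ⟨r, hr, hball⟩ := Metric.nhds_basis_closedBall.mem_iff.1
      ((isOpen_domainΩ n).mem_nhds hz₀)
    obtain ⟨c, hcW, hcz₀⟩ := Metric.mem_closure_iff.1 hz₀W (r / 2) (by positivity)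
    -- the point of `{u = v}` closest to `c`
    set Z : Set (SpaceTime n) := {p | p ∈ Metric.closedBall z₀ r ∧ u p = v p} with hZ
    have hZc : IsCompact Z := by
      have h1 := ((hcu.sub hcv).mono hball).preimage_isClosed_of_isClosed
        Metric.isClosed_closedBall (isClosed_singleton (x := (0 : ℝ)))
      have hZeq : Z = Metric.closedBall z₀ r ∩ (u - v) ⁻¹' {0} := by
        ext p; simp [hZ, sub_eq_zero]
      rw [hZeq]
      exact (isCompact_closedBall z₀ r).of_isClosed_subset h1 inter_subset_left
    have hz₀Z : z₀ ∈ Z := ⟨Metric.mem_closedBall_self hr.le, hz₀v⟩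
    obtain ⟨z, hz, hmin⟩ := hZc.exists_isMinOn ⟨z₀, hz₀Z⟩
      (f := fun p => ‖c - p‖) (by fun_prop)
    have hzr : ‖c - z‖ < r / 2 := by
      have h1 : ‖c - z‖ ≤ ‖c - z₀‖ := hmin hz₀Z
      rw [dist_comm, dist_eq_norm] at hcz₀
      linarith
    refine H.not_touching (hball hz.1) hz.2 (c := c) ?_ fun p hp hpΩ => ?_
    · rw [norm_pos_iff, sub_ne_zero]
      rintro rfl
      exact hcW.2.ne' hz.2
    · refine lt_of_le_of_ne (H.le p hpΩ) fun he => ?_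
      rw [Metric.mem_ball, dist_comm, dist_eq_norm] at hp
      have hpZ : p ∈ Z := by
        refine ⟨?_, he.symm⟩
        rw [Metric.mem_closedBall]
        have h1 := dist_triangle p c z₀
        rw [dist_comm p c, dist_eq_norm c p, dist_comm c z₀] at h1
        linarith
      exact absurd (hmin hpZ) (not_le.2 hp)
  exact fun p hp => (hsub hp).2

end Admissible

/-! ### The Hopf lemma at the origin -/

/-- The arithmetic behind the strict subsolution property of the barrier at the origin: `U`, `V`
and `D` stand for `∂ₜ u`, `∂ₜ² u` and a horizontal derivative of `∂ₜ u`. -/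
lemma hopf_arithmetic {ε a U V D N β A c s k : ℝ} (hε : 0 < ε) (ha : 1 ≤ a) (hβ : 0 ≤ β)
    (hU : 0 < U) (hc : 0 < c) (hs : 0 < s) (hV : c * s / 4 ≤ V)
    (hN : N ≤ ε) (hD : D ^ 2 ≤ k * U) (hk : 32 * A ^ 2 * k ≤ β * c * s) :
    0 < ε * β * U + 2 * (ε * (a * V) - ε * (2 * A * D)) - N * V := by
  have hcs : 0 < c * s := mul_pos hc hs
  have h1 : 4 * A * D < β * U + c * s / 4 := by
    have h2 : (4 * A * D) ^ 2 ≤ β * c * s * U / 2 := by nlinarith [sq_nonneg A]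
    have h3 : 0 < β * U + c * s / 4 := by positivity
    refine lt_of_pow_lt_pow_left₀ 2 h3.le (h2.trans_lt ?_)
    have h4 : 0 ≤ β * U := by positivity
    nlinarith [sq_nonneg (β * U - c * s / 4), mul_pos hcs hcs]
  have hVpos : 0 < V := by linarith
  have h5 : N * V ≤ ε * V := mul_le_mul_of_nonneg_right hN hVpos.le
  have h6 : ε * V ≤ ε * (a * V) := by
    have : V ≤ a * V := le_mul_of_one_le_left hVpos.le ha
    gcongr
  have h7 : ε * (4 * A * D) < ε * (β * U + V) := by
    gcongr; linarith
  nlinarith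

namespace Admissible

variable {n : ℕ} {u v : SpaceTime n → ℝ}

lemma ut_nonneg (H : Admissible u v) {p : SpaceTime n} (hp : p ∈ closure (domainΩ n)) :
    0 ≤ dirDeriv (timeDir n) u p := by
  have hc := (contDiffOn_dirDeriv H.smooth_u (timeDir n)).continuousOn
  have hclosed := hc.preimage_isClosed_of_isClosed isClosed_closure (isClosed_Ici (a := (0 : ℝ)))
  refine hclosed.closure_subset_iff.2
    (fun q hq => ?_) hp |>.2
  exact ⟨subset_closure hq, (H.ut_pos q hq).le⟩

/-- A horizontal derivative of the nonnegative function `∂ₜ u` is controlled by the square root of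
`∂ₜ u`, as follows from a second order expansion in the horizontal direction. -/
lemma exists_sq_horizontal_le (H : Admissible u v) :
    ∃ C, 0 ≤ C ∧ ∀ p ∈ domainΩ n, ‖p.snd‖ < 1 / 2 → ∀ y : EuclideanSpace ℝ (Fin n),
      dirDeriv (pt 0 y) (dirDeriv (timeDir n) u) p ^ 2 ≤
        C * ‖y‖ ^ 2 * dirDeriv (timeDir n) u p := by
  have hut := contDiffOn_dirDeriv H.smooth_u (timeDir n)
  obtain ⟨C, hC, hCle⟩ := exists_taylor_bound hut
  obtain ⟨M, hM, hMle⟩ := exists_dirDeriv_bound hut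
  set k : ℝ := C + M + 1 with hk
  have hkpos : 0 < k := by positivity
  refine ⟨4 * k, by positivity, fun p hp hpy y => ?_⟩
  set D := dirDeriv (pt 0 y) (dirDeriv (timeDir n) u) p with hD
  have hny : ‖pt 0 y‖ = ‖y‖ := by
    have := norm_sq_spaceTime (pt 0 y)
    simp only [pt_fst, pt_snd, ne_eq, OfNat.ofNat_ne_zero, not_false_eq_true, zero_pow,
      zero_add] at this
    exact (sq_eq_sq₀ (norm_nonneg _) (norm_nonneg _)).1 this
  have hDle : |D| ≤ M * ‖y‖ := by rw [← hny]; exact hMle p (subset_closure hp) _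
  rcases eq_or_ne y 0 with rfl | hy
  · have : D = 0 := by simpa using hDle
    rw [this]; simp
  have hy' : 0 < ‖y‖ := norm_pos_iff.2 hy
  -- the step that optimizes the expansion
  set η : ℝ := -(D / (2 * k * ‖y‖ ^ 2)) with hη
  have hηy : |η| * ‖y‖ ≤ 1 / 2 := by
    rw [hη, abs_neg, abs_div, abs_of_pos (show 0 < 2 * k * ‖y‖ ^ 2 by positivity),
      div_mul_eq_mul_div, div_le_iff₀ (by positivity)]
    have : |D| * ‖y‖ ≤ M * ‖y‖ * ‖y‖ := by gcongr
    nlinarith [sq_nonneg ‖y‖]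
  have hq : p + η • pt 0 y ∈ closure (domainΩ n) := by
    have e : p + η • pt 0 y = pt p.fst (p.snd + η • y) := by
      conv_lhs => rw [← pt_eta p, smul_pt, pt_add]
      simp
    rw [e]
    refine pt_mem_closure hp.1.le hp.2.1.le ((norm_add_le _ _).trans ?_)
    rw [norm_smul, Real.norm_eq_abs]
    linarith
  have h1 := (abs_le.1 (hCle p (subset_closure hp) _ hq)).2
  rw [add_sub_cancel_left, dirDeriv_smul_dir, ← hD, norm_smul, hny, mul_pow, Real.norm_eq_abs,
    sq_abs] at h1
  have h2 := H.ut_nonneg hq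
  have h3 : η * D = -(D ^ 2 / (2 * k * ‖y‖ ^ 2)) := by rw [hη]; ring
  have h4 : C * (η ^ 2 * ‖y‖ ^ 2) ≤ D ^ 2 / (4 * k * ‖y‖ ^ 2) := by
    have : C * (η ^ 2 * ‖y‖ ^ 2) = C / k * (D ^ 2 / (4 * k * ‖y‖ ^ 2)) := by
      rw [hη]; field_simp; ring
    rw [this]
    exact mul_le_of_le_one_left (by positivity) ((div_le_one hkpos).2 (by linarith))
  have h5 : D ^ 2 / (2 * k * ‖y‖ ^ 2) = 2 * (D ^ 2 / (4 * k * ‖y‖ ^ 2)) := by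
    field_simp; ring
  have h6 : D ^ 2 / (4 * k * ‖y‖ ^ 2) ≤ dirDeriv (timeDir n) u p := by linarith
  rw [div_le_iff₀ (by positivity)] at h6
  linarith

set_option maxHeartbeats 1000000 in
/-- **Hopf lemma at the origin.** If `v < u` in `Ω` and `∂ₜ² u ≥ c t - C |y|²` near the origin,
the time shift grows at least linearly along the time axis. -/
theorem exists_shift_origin (H : Admissible u v) (hlt : ∀ p ∈ domainΩ n, v p < u p)
    {c C r : ℝ} (hc : 0 < c) (hC : 0 ≤ C) (hr : 0 < r)
    (hutt : ∀ p ∈ domainΩ n, ‖p‖ < r →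
      c * p.fst - C * ‖p.snd‖ ^ 2 ≤ dirDeriv (timeDir n) (dirDeriv (timeDir n) u) p) :
    ∃ ε > 0, ε < 1 ∧ ∃ h > 0, ∀ s, 0 < s → s < h → ∀ t, 0 ≤ t → t ≤ s →
      u (pt t 0) = v (pt s 0) → t ≤ (1 - ε) * s := by
  obtain ⟨C₁, hC₁, hhor⟩ := H.exists_sq_horizontal_le
  set A : ℝ := 8 * C / c + 1 with hA
  have hA1 : 1 ≤ A := by
    have : 0 ≤ 8 * C / c := by positivity
    linarith
  have hAC : 8 * C ≤ A * c := by
    have : 8 * C / c * c = 8 * C := by field_simp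
    nlinarith
  set β : ℝ := 64 * A * C₁ / c with hβ
  have hβ0 : 0 ≤ β := by positivity
  have hβc : β * c = 64 * A * C₁ := by rw [hβ]; field_simp
  set B : ℝ := A * (n + 1) + β / 2 with hB
  have hBA : A ≤ B := by
    have : 0 ≤ A * n := by positivity
    rw [hB]; linarith
  have hB1 : 1 ≤ B := hA1.trans hBA
  set h : ℝ := min (1 / (8 * B)) (r ^ 2 / 4) with hh
  have hhpos : 0 < h := by positivity
  have hBh : B * h ≤ 1 / 8 := by
    have : h ≤ 1 / (8 * B) := min_le_left _ _
    rw [le_div_iff₀ (by positivity)] at this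
    linarith
  have hAh : A * h ≤ 1 / 8 := (mul_le_mul_of_nonneg_right hBA hhpos.le).trans hBh
  have hh8 : h ≤ 1 / 8 := by
    have := le_mul_of_one_le_left hhpos.le hB1
    linarith
  have hhr : h ≤ r ^ 2 / 4 := min_le_right _ _
  have hinn : ∀ p : SpaceTime n, inner ℝ (timeDir n) (p - 0) = p.fst := fun p => by
    rw [sub_zero, real_inner_comm, inner_timeDir]
  -- size of the region where the barrier is positive
  have hquad : ∀ p : SpaceTime n, 0 ≤ p.fst → p.fst ≤ h → A * ‖p‖ ^ 2 ≤ p.fst + B * p.fst ^ 2 →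
      A * ‖p.snd‖ ^ 2 ≤ 2 * p.fst ∧ ‖p.snd‖ < 1 / 2 ∧ B * p.fst ≤ 1 / 8 := by
    intro p h0 h1 h2
    have h3 : B * p.fst ≤ 1 / 8 := (mul_le_mul_of_nonneg_left h1 (by linarith)).trans hBh
    have h4 : B * p.fst ^ 2 ≤ p.fst := by
      have := mul_le_mul_of_nonneg_right h3 h0
      linarith
    have h5 : A * ‖p.snd‖ ^ 2 ≤ A * ‖p‖ ^ 2 := by
      rw [norm_sq_spaceTime p]; gcongr; linarith [sq_nonneg p.fst]
    have h6 : A * ‖p.snd‖ ^ 2 ≤ 2 * p.fst := by linarith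
    refine ⟨h6, ?_, h3⟩
    have h7 : ‖p.snd‖ ^ 2 ≤ A * ‖p.snd‖ ^ 2 := le_mul_of_one_le_left (by positivity) hA1
    have h8 : ‖p.snd‖ ^ 2 ≤ 1 / 4 := by linarith
    by_contra! hcon
    have h9 : ‖p.snd‖ ^ 2 = 1 / 4 := le_antisymm h8 (by
      have := pow_le_pow_left₀ (by norm_num) hcon 2
      linarith)
    have h10 : p.fst = h := by linarith
    have : 0 < p.fst := by linarith
    have h11 : B * p.fst ^ 2 < p.fst := by
      have := mul_le_mul_of_nonneg_right h3 h0
      linarith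
    linarith
  have hΩ : ∀ p : SpaceTime n, 0 < p.fst → p.fst ≤ h → A * ‖p‖ ^ 2 ≤ p.fst + B * p.fst ^ 2 →
      p ∈ domainΩ n := fun p h0 h1 h2 =>
    ⟨h0, by linarith, by linarith [(hquad p h0.le h1 h2).2.1]⟩
  set K : Set (SpaceTime n) := {p | p.fst = h ∧ A * ‖p‖ ^ 2 ≤ p.fst + B * p.fst ^ 2} with hK
  have hKsub : K ⊆ domainΩ n := fun p hp => hΩ p (hp.1 ▸ hhpos) hp.1.le hp.2
  have hKc : IsCompact K :=
    (isCompact_closure_domainΩ n).of_isClosed_subset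
      ((isClosed_eq continuous_fst' continuous_const).inter (isClosed_le
        (f := fun p : SpaceTime n => A * ‖p‖ ^ 2)
        (g := fun p : SpaceTime n => p.fst + B * p.fst ^ 2) (by fun_prop) (by fun_prop)))
      (hKsub.trans subset_closure)
  obtain ⟨c₀, hc₀, hshift⟩ := H.exists_shift_bound hKc hKsub fun p hp => hlt p (hKsub hp)
  set ε : ℝ := min (1 / 5) (c₀ / (2 * h)) with hε
  have hεpos : 0 < ε := by positivity
  have hε5 : ε ≤ 1 / 5 := min_le_left _ _
  have hεc : ε * (2 * h) ≤ c₀ := by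
    have : ε ≤ c₀ / (2 * h) := min_le_right _ _
    rwa [le_div_iff₀ (by positivity)] at this
  have hpos_iff : ∀ p, 0 ≤ barrier 0 (timeDir n) ε B A p →
      A * ‖p‖ ^ 2 ≤ p.fst + B * p.fst ^ 2 := fun p hp => by
    rw [barrier, hinn, sub_zero] at hp
    have := nonneg_of_mul_nonneg_right hp hεpos
    linarith
  have hφle : ∀ p : SpaceTime n, 0 ≤ p.fst → p.fst ≤ h →
      barrier 0 (timeDir n) ε B A p ≤ ε * (2 * p.fst) := fun p h0 h1 => by
    rw [barrier, hinn, sub_zero]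
    gcongr
    have h3 : B * p.fst ≤ 1 / 8 := (mul_le_mul_of_nonneg_left h1 (by linarith)).trans hBh
    have h4 : 0 ≤ A * ‖p‖ ^ 2 := by positivity
    have := mul_le_mul_of_nonneg_right h3 h0
    linarith
  have hstrict : ∀ p : SpaceTime n, 0 < p.fst → p.fst < h → 0 < barrier 0 (timeDir n) ε B A p →
      ∀ t, 0 < t → t ≤ p.fst → p.fst - t < barrier 0 (timeDir n) ε B A p →
      0 < 2 * (ε * B - ε * A * (n + 1)) * dirDeriv (timeDir n) u (pt t p.snd)
        + 2 * dirDeriv (barrierGrad 0 (timeDir n) ε B A p) (dirDeriv (timeDir n) u) (pt t p.snd)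
        - ‖barrierGrad 0 (timeDir n) ε B A p‖ ^ 2 *
          dirDeriv (timeDir n) (dirDeriv (timeDir n) u) (pt t p.snd) := by
    intro p h0 h1 h2 t ht hts htφ
    obtain ⟨hy2, hy1, hBs⟩ := hquad p h0.le h1.le (hpos_iff p h2.le)
    have hq : pt t p.snd ∈ domainΩ n := ⟨ht, by rw [pt_fst]; linarith, by rw [pt_snd]; linarith⟩
    have hths : p.fst / 2 ≤ t := by
      have h3 := hφle p h0.le h1.le
      have h4 : ε * (2 * p.fst) ≤ 1 / 5 * (2 * p.fst) := by gcongr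
      linarith
    have hyle : ‖p.snd‖ ^ 2 ≤ 2 * p.fst :=
      (le_mul_of_one_le_left (by positivity) hA1).trans hy2
    have hqr : ‖pt t p.snd‖ < r := by
      rw [← sq_lt_sq₀ (norm_nonneg _) hr.le, norm_sq_spaceTime, pt_fst, pt_snd]
      have h3 : t ^ 2 ≤ p.fst := by
        have : t * t ≤ p.fst * 1 := mul_le_mul hts (by linarith) ht.le h0.le
        linarith
      linarith
    set a : ℝ := 1 + 2 * (B - A) * p.fst with ha
    have hgrad : barrierGrad 0 (timeDir n) ε B A p
        = ε • (a • timeDir n - (2 * A) • pt 0 p.snd) := by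
      rw [barrierGrad, hinn, sub_zero]
      congr 1
      have e : p = p.fst • timeDir n + pt 0 p.snd := pt_eq_add p.fst p.snd
      have e' : (2 * A) • p = (2 * A) • (p.fst • timeDir n + pt 0 p.snd) := by rw [← e]
      rw [e', ha]
      module
    have hnorm : ‖barrierGrad 0 (timeDir n) ε B A p‖ ^ 2
        = ε ^ 2 * (a ^ 2 + 4 * A * (A * ‖p.snd‖ ^ 2)) := by
      rw [hgrad, norm_smul, mul_pow, Real.norm_of_nonneg hεpos.le]
      congr 1
      have e : a • timeDir n - (2 * A) • pt 0 p.snd = pt a (-((2 * A) • p.snd)) := by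
        simp [timeDir, smul_pt, pt_sub]
      rw [e, norm_sq_spaceTime, pt_fst, pt_snd, norm_neg, norm_smul,
        Real.norm_of_nonneg (by positivity)]
      ring
    have ha1 : 1 ≤ a := by
      have : 0 ≤ 2 * (B - A) * p.fst := by
        have := sub_nonneg.2 hBA
        positivity
      linarith
    have ha2 : a ≤ 5 / 4 := by
      have : 0 ≤ A * p.fst := by positivity
      rw [ha]; linarith
    have hAs : A * p.fst ≤ 1 / 8 := (mul_le_mul_of_nonneg_left h1.le (by linarith)).trans hAh
    have hN : ‖barrierGrad 0 (timeDir n) ε B A p‖ ^ 2 ≤ ε := by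
      rw [hnorm]
      have e1 : a ^ 2 ≤ (5 / 4) ^ 2 := by gcongr
      have e2 : 4 * A * (A * ‖p.snd‖ ^ 2) ≤ 4 * A * (2 * p.fst) := by gcongr
      have e3 : a ^ 2 + 4 * A * (A * ‖p.snd‖ ^ 2) ≤ 5 := by linarith
      calc ε ^ 2 * (a ^ 2 + 4 * A * (A * ‖p.snd‖ ^ 2)) ≤ ε ^ 2 * 5 := by gcongr
        _ = ε * (5 * ε) := by ring
        _ ≤ ε * 1 := by gcongr; linarith
        _ = ε := mul_one ε
    have hV : c * p.fst / 4 ≤ dirDeriv (timeDir n) (dirDeriv (timeDir n) u) (pt t p.snd) := by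
      have h3 := hutt _ hq hqr
      rw [pt_fst, pt_snd] at h3
      have h4 : 8 * C * ‖p.snd‖ ^ 2 ≤ A * c * ‖p.snd‖ ^ 2 := by gcongr
      have h5 : c * (A * ‖p.snd‖ ^ 2) ≤ c * (2 * p.fst) := by gcongr
      have h6 : c * (p.fst / 2) ≤ c * t := by gcongr
      linarith
    have hD := hhor _ hq (by rw [pt_snd]; exact hy1) p.snd
    have hk : 32 * A ^ 2 * (C₁ * ‖p.snd‖ ^ 2) ≤ β * c * p.fst := by
      rw [hβc]
      have : 32 * A * C₁ * (A * ‖p.snd‖ ^ 2) ≤ 32 * A * C₁ * (2 * p.fst) := by gcongr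
      linarith
    have key := hopf_arithmetic (a := a) hεpos ha1 hβ0 (H.ut_pos _ hq) hc h0 hV hN hD hk
    have e1 : dirDeriv (barrierGrad 0 (timeDir n) ε B A p) (dirDeriv (timeDir n) u) (pt t p.snd)
        = ε * (a * dirDeriv (timeDir n) (dirDeriv (timeDir n) u) (pt t p.snd)
          - 2 * A * dirDeriv (pt 0 p.snd) (dirDeriv (timeDir n) u) (pt t p.snd)) := by
      rw [hgrad, dirDeriv_smul_dir, sub_eq_add_neg, dirDeriv_add_dir, dirDeriv_neg_dir,
        dirDeriv_smul_dir, dirDeriv_smul_dir]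
      ring
    have e2 : 2 * (ε * B - ε * A * (n + 1)) = ε * β := by rw [hB]; ring
    rw [e1, e2]
    refine key.trans_le (le_of_eq ?_)
    ring
  have hmain := H.barrier_le (z := 0) (norm_timeDir n) (ε := ε) (B := B) (A := A) (h := h)
    hεpos.le (by linarith)
  simp only [hinn] at hmain
  refine ⟨ε, hεpos, by linarith, h, hhpos, fun s hs hsh t ht hts hlev => ?_⟩
  have h1 := hmain
    (fun p h0 h1 h2 => ⟨h0, by linarith, by linarith [(hquad p h0 h1 (hpos_iff p h2)).2.1]⟩)
    (fun p h0 _ _ => h0)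
    (fun p h0 h1 t h2 h3 h4 => by
      have e1 := hφle p (h0 ▸ hhpos.le) h0.le
      rw [h0] at e1
      exact (e1.trans hεc).trans (hshift p ⟨h0, hpos_iff p h1⟩ t h2 h3 h4))
    hstrict (pt s 0) hs.le hsh.le t ht hts hlev
  have h2 : ‖pt s (0 : EuclideanSpace ℝ (Fin n))‖ ^ 2 = s ^ 2 := by
    rw [norm_sq_spaceTime]; simp
  rw [barrier, hinn, sub_zero, h2, pt_fst] at h1
  have h3 : ε * s ≤ ε * (s + B * s ^ 2 - A * s ^ 2) := by
    have := mul_le_mul_of_nonneg_right hBA (sq_nonneg s)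
    gcongr; linarith
  linarith

end Admissible

/-! ### Expansions at the initial time -/

/-- Two functions on an interval are ordered if their initial values and derivatives are. -/
lemma le_of_hasDerivWithinAt_le {f g f' g' : ℝ → ℝ} {b : ℝ}
    (hf : ∀ x ∈ Icc 0 b, HasDerivWithinAt f (f' x) (Icc 0 b) x)
    (hg : ∀ x ∈ Icc 0 b, HasDerivWithinAt g (g' x) (Icc 0 b) x)
    (h0 : f 0 ≤ g 0) (hle : ∀ x ∈ Icc 0 b, f' x ≤ g' x) : ∀ x ∈ Icc 0 b, f x ≤ g x := by
  intro x hx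
  have hmono : MonotoneOn (fun x => g x - f x) (Icc 0 b) := by
    refine monotoneOn_of_deriv_nonneg (convex_Icc _ _)
      (fun y hy => ((hg y hy).sub (hf y hy)).continuousWithinAt) (fun y hy => ?_) fun y hy => ?_
    · exact (((hg y (interior_subset hy)).sub (hf y (interior_subset hy))).mono
        interior_subset).differentiableWithinAt
    · have hy' := interior_subset hy
      rw [interior_Icc] at hy
      have := ((hg y hy').sub (hf y hy')).hasDerivAt (Icc_mem_nhds hy.1 hy.2)
      refine (?_ : (0 : ℝ) ≤ g' y - f' y).trans_eq this.deriv.symm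
      exact sub_nonneg.2 (hle y hy')
  have := hmono ⟨le_rfl, hx.1.trans hx.2⟩ hx hx.1
  simp only at this
  linarith

/-- The inclusion of `ℝⁿ` into space-time at time `0`, as a continuous linear map. -/
noncomputable def sliceCLM (n : ℕ) : EuclideanSpace ℝ (Fin n) →L[ℝ] SpaceTime n :=
  ((WithLp.prodContinuousLinearEquiv 2 ℝ ℝ (EuclideanSpace ℝ (Fin n))).symm :
    ℝ × EuclideanSpace ℝ (Fin n) →L[ℝ] SpaceTime n).comp
    (ContinuousLinearMap.inr ℝ ℝ (EuclideanSpace ℝ (Fin n)))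

@[simp] lemma sliceCLM_apply {n : ℕ} (y : EuclideanSpace ℝ (Fin n)) : sliceCLM n y = pt 0 y := rfl

section slice

variable {n : ℕ} {w : SpaceTime n → ℝ}

lemma hasFDerivAt_slice (hw : ContDiffOn ℝ ∞ w (closure (domainΩ n)))
    {y : EuclideanSpace ℝ (Fin n)} (hy : ‖y‖ < 1) :
    HasFDerivAt (fun y => w (pt 0 y))
      ((fderivWithin ℝ w (closure (domainΩ n)) (pt 0 y)).comp (sliceCLM n)) y := by
  have h1 : HasFDerivWithinAt w (fderivWithin ℝ w (closure (domainΩ n)) (pt 0 y))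
      (closure (domainΩ n)) (sliceCLM n y) :=
    ((hw.differentiableOn (by simp)) _ (pt_mem_closure le_rfl zero_le_one hy.le)).hasFDerivWithinAt
  have h2 := h1.comp y ((sliceCLM n).hasFDerivAt.hasFDerivWithinAt (s := Metric.ball 0 1))
    (fun z hz => pt_mem_closure le_rfl zero_le_one (by
      rw [mem_ball_zero_iff] at hz; exact hz.le))
  exact h2.hasFDerivAt (Metric.isOpen_ball.mem_nhds (by rwa [mem_ball_zero_iff]))

lemma dirDeriv_slice_of_hasFDerivAt_zero (hw : ContDiffOn ℝ ∞ w (closure (domainΩ n)))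
    {y : EuclideanSpace ℝ (Fin n)} (hy : ‖y‖ < 1)
    (h0 : HasFDerivAt (fun y => w (pt 0 y)) (0 : EuclideanSpace ℝ (Fin n) →L[ℝ] ℝ) y)
    (z : EuclideanSpace ℝ (Fin n)) : dirDeriv (pt 0 z) w (pt 0 y) = 0 := by
  have := congrArg (fun L : EuclideanSpace ℝ (Fin n) →L[ℝ] ℝ => L z)
    ((hasFDerivAt_slice hw hy).unique h0)
  simpa [dirDeriv] using this

lemma dirDeriv_slice_eq_zero (hw : ContDiffOn ℝ ∞ w (closure (domainΩ n)))
    (h0 : ∀ y : EuclideanSpace ℝ (Fin n), ‖y‖ < 1 → w (pt 0 y) = 0)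
    {y : EuclideanSpace ℝ (Fin n)} (hy : ‖y‖ < 1) (z : EuclideanSpace ℝ (Fin n)) :
    dirDeriv (pt 0 z) w (pt 0 y) = 0 := by
  refine dirDeriv_slice_of_hasFDerivAt_zero hw hy ?_ z
  refine (hasFDerivAt_const (0 : ℝ) y).congr_of_eventuallyEq ?_
  filter_upwards [Metric.isOpen_ball.mem_nhds (mem_ball_zero_iff.2 hy)] with x hx
  exact h0 x (mem_ball_zero_iff.1 hx)

lemma dirDeriv_slice_of_nonneg (hw : ContDiffOn ℝ ∞ w (closure (domainΩ n)))
    (h0 : ∀ p ∈ closure (domainΩ n), 0 ≤ w p) (hw0 : w 0 = 0) (z : EuclideanSpace ℝ (Fin n)) :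
    dirDeriv (pt 0 z) w 0 = 0 := by
  have hd := hasFDerivAt_slice hw (y := 0) (by simp)
  have hmin : IsLocalMin (fun y : EuclideanSpace ℝ (Fin n) => w (pt 0 y)) 0 := by
    filter_upwards [Metric.isOpen_ball.mem_nhds
      (mem_ball_zero_iff.2 (by simp : ‖(0 : EuclideanSpace ℝ (Fin n))‖ < 1))] with y hy
    rw [pt_zero_zero, hw0]
    exact h0 _ (pt_mem_closure le_rfl zero_le_one (mem_ball_zero_iff.1 hy).le)
  have he := hmin.hasFDerivAt_eq_zero hd
  rw [he] at hd
  exact dirDeriv_slice_of_hasFDerivAt_zero hw (by simp) hd z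

lemma dirDeriv_congr {w₁ w₂ : SpaceTime n → ℝ} (h : EqOn w₁ w₂ (closure (domainΩ n)))
    {p : SpaceTime n} (hp : p ∈ closure (domainΩ n)) (e : SpaceTime n) :
    dirDeriv e w₁ p = dirDeriv e w₂ p := by
  rw [dirDeriv, fderivWithin_congr h (h hp), dirDeriv]

lemma dirDeriv_closedLaplacian (hw : ContDiffOn ℝ ∞ w (closure (domainΩ n))) {p : SpaceTime n}
    (hp : p ∈ closure (domainΩ n)) (e : SpaceTime n) :
    dirDeriv e (closedLaplacian w) p =
      dirDeriv e (dirDeriv (timeDir n) (dirDeriv (timeDir n) w)) p +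
      ∑ i, dirDeriv e (dirDeriv (pt 0 (EuclideanSpace.single i 1))
        (dirDeriv (pt 0 (EuclideanSpace.single i 1)) w)) p := by
  have hd : ∀ f : SpaceTime n, HasFDerivWithinAt (dirDeriv f (dirDeriv f w))
      (fderivWithin ℝ (dirDeriv f (dirDeriv f w)) (closure (domainΩ n)) p)
      (closure (domainΩ n)) p := fun f =>
    (((contDiffOn_dirDeriv (contDiffOn_dirDeriv hw f) f).differentiableOn (by simp)) p
      hp).hasFDerivWithinAt
  have h := (hd (timeDir n)).add (HasFDerivWithinAt.fun_sum (u := Finset.univ) fun i _ =>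
    hd (pt 0 (EuclideanSpace.single i 1)))
  have h' : HasFDerivWithinAt (closedLaplacian w) _ (closure (domainΩ n)) p := h
  rw [dirDeriv, h'.fderivWithin (uniqueDiffOn_closure_domainΩ n p hp)]
  simp [dirDeriv]

lemma closedLaplacian_slice (hw : ContDiffOn ℝ ∞ w (closure (domainΩ n)))
    (h0 : ∀ y : EuclideanSpace ℝ (Fin n), ‖y‖ < 1 → w (pt 0 y) = 0)
    {y : EuclideanSpace ℝ (Fin n)} (hy : ‖y‖ < 1) :
    closedLaplacian w (pt 0 y) = dirDeriv (timeDir n) (dirDeriv (timeDir n) w) (pt 0 y) := by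
  rw [closedLaplacian, Finset.sum_eq_zero, add_zero]
  exact fun i _ => dirDeriv_slice_eq_zero (contDiffOn_dirDeriv hw _)
    (fun z hz => dirDeriv_slice_eq_zero hw h0 hz _) hy _

/-- Leading behaviour along the time axis of a function whose first `m` time derivatives vanish at
the origin. -/
lemma tendsto_time_div_pow (hw : ContDiffOn ℝ ∞ w (closure (domainΩ n))) {m : ℕ}
    (h0 : ∀ i < m, (dirDeriv (timeDir n))^[i] w 0 = 0) :
    Tendsto (fun s : ℝ => w (pt s 0) / s ^ m) (𝓝[>] 0)
      (𝓝 ((dirDeriv (timeDir n))^[m] w 0 / m.factorial)) := by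
  have hd := iteratedDerivWithin_time hw (y := 0) (by simp)
  have h01 : (0 : ℝ) ∈ Icc (0 : ℝ) 1 := ⟨le_rfl, zero_le_one⟩
  have hval : ∀ i, iteratedDerivWithin i (fun t => w (pt t 0)) (Icc 0 1) 0
      = (dirDeriv (timeDir n))^[i] w 0 := fun i => (hd i).1 h01
  have hsm : ContDiffOn ℝ m (fun t => w (pt t 0)) (Icc 0 1) := by
    have hc : ContDiffOn ℝ ∞ (fun t : ℝ => w (0 + t • timeDir n)) (Icc 0 1) := by
      refine hw.comp (f := fun t : ℝ => (0 : SpaceTime n) + t • timeDir n)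
        (ContDiff.contDiffOn (by fun_prop)) fun t ht => ?_
      change pt 0 0 + t • timeDir n ∈ _
      rw [pt_add_smul_timeDir, zero_add]
      exact pt_mem_closure ht.1 ht.2 (by simp)
    refine (hc.of_le (by exact_mod_cast le_top)).congr fun t _ => ?_
    rw [← pt_zero_zero, pt_add_smul_timeDir, zero_add]
  have ht := Real.taylor_tendsto (convex_Icc (0 : ℝ) 1) h01 hsm
  have hpoly : ∀ x, taylorWithinEval (fun t => w (pt t 0)) m (Icc 0 1) 0 x
      = (dirDeriv (timeDir n))^[m] w 0 / m.factorial * x ^ m := fun x => by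
    rw [taylor_within_apply, Finset.sum_range_succ, Finset.sum_eq_zero]
    · rw [hval, smul_eq_mul, sub_zero]; ring
    · intro i hi
      rw [hval, h0 i (Finset.mem_range.1 hi), smul_zero]
  have ht' := ht.mono_left (nhdsWithin_le_of_mem (Icc_mem_nhdsGT zero_lt_one))
  have := ht'.add_const ((dirDeriv (timeDir n))^[m] w 0 / m.factorial)
  rw [zero_add] at this
  refine this.congr' ?_
  filter_upwards [self_mem_nhdsWithin] with s hs
  have hs' : s ≠ 0 := (mem_Ioi.1 hs).ne'
  rw [hpoly, sub_zero]
  field_simp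
  ring

end slice

/-! ### The averaged inequality in the degenerate case -/

section expansions

variable {n : ℕ} {w : SpaceTime n → ℝ}

lemma exists_second_order_le (hw : ContDiffOn ℝ ∞ w (closure (domainΩ n))) (e : SpaceTime n) :
    ∃ C, 0 ≤ C ∧ ∀ p, (∀ h ∈ Icc (0 : ℝ) 1, p + h • e ∈ closure (domainΩ n)) →
      ∀ h ∈ Icc (0 : ℝ) 1, w (p + h • e) ≤
        w p + h * dirDeriv e w p + h ^ 2 / 2 * dirDeriv e (dirDeriv e w) p + C * h ^ 3 := by
  have hw1 := contDiffOn_dirDeriv hw e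
  obtain ⟨L, hL, hLle⟩ := exists_lipschitz_bound (contDiffOn_dirDeriv hw1 e)
  set M : ℝ := L * ‖e‖
  have hM : 0 ≤ M := by positivity
  refine ⟨M / 6, by positivity, fun p hp => ?_⟩
  have hp0 : p ∈ closure (domainΩ n) := by simpa using hp 0 ⟨le_rfl, zero_le_one⟩
  set b := dirDeriv e w p
  set c := dirDeriv e (dirDeriv e w) p
  have hpoly1 : ∀ h : ℝ, HasDerivAt (fun h : ℝ => b + c * h + M / 2 * h ^ 2) (c + M * h) h :=
    fun h => by
      have := ((hasDerivAt_id h).const_mul c).const_add b |>.add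
        (((hasDerivAt_id h).pow 2).const_mul (M / 2))
      refine this.congr_deriv ?_
      simp; ring
  have hpoly2 : ∀ h : ℝ, HasDerivAt (fun h : ℝ => w p + h * b + h ^ 2 / 2 * c + M / 6 * h ^ 3)
      (b + c * h + M / 2 * h ^ 2) h := fun h => by
    have := ((((hasDerivAt_id h).mul_const b).const_add (w p)).add
      ((((hasDerivAt_id h).pow 2).div_const 2).mul_const c)).add
        (((hasDerivAt_id h).pow 3).const_mul (M / 6))
    refine this.congr_deriv ?_
    simp; ring
  have h1 := le_of_hasDerivWithinAt_le
    (fun h hh => hasDerivWithinAt_line hw1 hp hh)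
    (fun h _ => (hpoly1 h).hasDerivWithinAt) (by simp [b]) (fun h hh => by
      have h2 := (abs_le.1 (hLle p hp0 _ (hp h hh))).2
      rw [add_sub_cancel_left, norm_smul, Real.norm_of_nonneg hh.1] at h2
      have h3 : L * (h * ‖e‖) = M * h := by simp only [M]; ring
      simp only [c]
      linarith)
  exact le_of_hasDerivWithinAt_le (fun h hh => hasDerivWithinAt_line hw hp hh)
    (fun h _ => (hpoly2 h).hasDerivWithinAt) (by simp) h1

lemma dirDeriv_neg_neg (hw : ContDiffOn ℝ ∞ w (closure (domainΩ n))) (e : SpaceTime n)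
    {p : SpaceTime n} (hp : p ∈ closure (domainΩ n)) :
    dirDeriv (-e) (dirDeriv (-e) w) p = dirDeriv e (dirDeriv e w) p := by
  have h1 : dirDeriv (-e) w = fun p => -dirDeriv e w p := funext fun p => dirDeriv_neg_dir e p
  have h2 := (((contDiffOn_dirDeriv hw e).differentiableOn (by simp)) p hp).hasFDerivWithinAt.neg
  have h3 : HasFDerivWithinAt (fun p => -dirDeriv e w p) _ (closure (domainΩ n)) p := h2
  rw [h1, dirDeriv_neg_dir, dirDeriv, h3.fderivWithin (uniqueDiffOn_closure_domainΩ n p hp)]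
  simp [dirDeriv]

lemma exists_symmetric_ge (hw : ContDiffOn ℝ ∞ w (closure (domainΩ n))) (e : SpaceTime n) :
    ∃ C, 0 ≤ C ∧ ∀ p, (∀ h ∈ Icc (0 : ℝ) 1, p + h • e ∈ closure (domainΩ n)) →
      (∀ h ∈ Icc (0 : ℝ) 1, p + h • -e ∈ closure (domainΩ n)) →
      ∀ h ∈ Icc (0 : ℝ) 1, 2 * w p + h ^ 2 * dirDeriv e (dirDeriv e w) p - C * h ^ 4 ≤
        w (p + h • e) + w (p + h • -e) := by
  have hw1 := contDiffOn_dirDeriv hw e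
  have hw1' := contDiffOn_dirDeriv hw (-e)
  obtain ⟨L, hL, hLle⟩ := exists_taylor_bound (contDiffOn_dirDeriv hw1 e)
  set M : ℝ := 2 * L * ‖e‖ ^ 2
  have hM : 0 ≤ M := by positivity
  refine ⟨M / 12, by positivity, fun p hp hp' => ?_⟩
  have hp0 : p ∈ closure (domainΩ n) := by simpa using hp 0 ⟨le_rfl, zero_le_one⟩
  set c := dirDeriv e (dirDeriv e w) p
  have hpoly1 : ∀ h : ℝ, HasDerivAt (fun h : ℝ => 2 * c * h - M / 3 * h ^ 3)
      (2 * c - M * h ^ 2) h := fun h => by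
    have := ((hasDerivAt_id h).const_mul (2 * c)).sub (((hasDerivAt_id h).pow 3).const_mul (M / 3))
    refine this.congr_deriv ?_
    simp; ring
  have hpoly2 : ∀ h : ℝ, HasDerivAt (fun h : ℝ => 2 * w p + h ^ 2 * c - M / 12 * h ^ 4)
      (2 * c * h - M / 3 * h ^ 3) h := fun h => by
    have := ((((hasDerivAt_id h).pow 2).mul_const c).const_add (2 * w p)).sub
        (((hasDerivAt_id h).pow 4).const_mul (M / 12))
    refine this.congr_deriv ?_
    simp; ring
  have h1 := le_of_hasDerivWithinAt_le (b := 1)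
    (fun h _ => (hpoly1 h).hasDerivWithinAt)
    (fun h hh => (hasDerivWithinAt_line hw1 hp hh).add (hasDerivWithinAt_line hw1' hp' hh))
    (by simp [dirDeriv_neg_dir]) (fun h hh => by
      have h2 := (abs_le.1 (hLle p hp0 _ (hp h hh))).1
      have h3 := (abs_le.1 (hLle p hp0 _ (hp' h hh))).1
      rw [add_sub_cancel_left, dirDeriv_smul_dir, norm_smul, Real.norm_of_nonneg hh.1] at h2 h3
      rw [dirDeriv_neg_dir, norm_neg] at h3
      rw [dirDeriv_neg_neg hw e (hp' h hh)]
      have h4 : M * h ^ 2 = 2 * (L * (h * ‖e‖) ^ 2) := by simp only [M]; ring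
      simp only [c]
      linarith)
  exact le_of_hasDerivWithinAt_le (b := 1) (fun h _ => (hpoly2 h).hasDerivWithinAt)
    (fun h hh => (hasDerivWithinAt_line hw hp hh).add (hasDerivWithinAt_line hw hp' hh))
    (by simp; linarith) h1

/-- The sum of the values at two symmetric points, up to second order. -/
lemma exists_symmetric_le (hw : ContDiffOn ℝ ∞ w (closure (domainΩ n))) :
    ∃ C, 0 ≤ C ∧ ∀ (s : ℝ) (y : EuclideanSpace ℝ (Fin n)), 0 ≤ s → s ≤ 1 → ‖y‖ ≤ 1 →
      w (pt s y) + w (pt s (-y)) ≤ 2 * w (pt s 0) + 2 * C * ‖y‖ ^ 2 := by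
  obtain ⟨C, hC, hCle⟩ := exists_taylor_bound hw
  refine ⟨C, hC, fun s y h0 h1 hy => ?_⟩
  have hp := pt_mem_closure h0 h1 (by simp : ‖(0 : EuclideanSpace ℝ (Fin n))‖ ≤ 1)
  have h2 := (abs_le.1 (hCle _ hp _ (pt_mem_closure h0 h1 hy))).2
  have h3 := (abs_le.1 (hCle _ hp _ (pt_mem_closure h0 h1 (by rwa [norm_neg] : ‖-y‖ ≤ 1)))).2
  rw [pt_sub] at h2 h3
  have e1 : pt (s - s) (-y - 0) = -pt (s - s) (y - 0) := by
    rw [← sub_eq_zero, sub_neg_eq_add, pt_add]; simp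
  have e2 : ‖pt (s - s) (y - 0)‖ ^ 2 = ‖y‖ ^ 2 := by rw [norm_sq_spaceTime]; simp
  rw [e1, dirDeriv_neg_dir, norm_neg, e2] at h3
  rw [e2] at h2
  linarith

end expansions

/-- The arithmetic that combines the main condition at two symmetric points at distance `x ^ 3`
from the time axis with the expansions of `u` and `v`; here `x ^ 4` is the Laplacian of `v` on the
axis, and `c` is a pure second derivative of `v` there. -/
lemma averaging_arithmetic {x t₁ t₂ a c d C₁ C₂ C₄ C₅ k : ℝ} (hx : 0 < x) (hx1 : x ≤ 1)
    (ht₁ : 0 ≤ t₁) (ht₂ : 0 ≤ t₂) (ha : 0 < a) (hd : 0 ≤ d) (hC₁ : 0 ≤ C₁) (hC₂ : 0 ≤ C₂)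
    (hC₅ : 0 ≤ C₅) (hk : k = 4 / a * (1 + C₁ + C₂))
    (hmain : a * (t₁ + t₂) - C₁ * (t₁ ^ 2 + t₂ ^ 2 + 2 * x ^ 6) ≤ 2 * x ^ 4 + 2 * C₂ * x ^ 6)
    (hsmall : C₁ * (t₁ + t₂) ≤ a / 2)
    (hc : c * x ^ 6 - C₄ * x ^ 12 ≤ t₁ * (d / 2 * x ^ 6 + C₅ * (x ^ 9 + t₁ * x ^ 6 + t₁ ^ 2))
      + t₂ * (d / 2 * x ^ 6 + C₅ * (x ^ 9 + t₂ * x ^ 6 + t₂ ^ 2))) :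
    c ≤ d / a * x ^ 4
      + (d / (2 * a) * (C₁ * k ^ 2 + 2 * C₁ + 2 * C₂) + C₄ + C₅ * (k + k ^ 2 + k ^ 3)) * x ^ 6 := by
  have hk0 : 0 ≤ k := by rw [hk]; positivity
  set T := t₁ + t₂ with hT
  have hT0 : 0 ≤ T := by positivity
  have hx64 : x ^ 6 ≤ x ^ 4 := pow_le_pow_of_le_one hx.le hx1 (by norm_num)
  have hx86 : x ^ 8 ≤ x ^ 6 := pow_le_pow_of_le_one hx.le hx1 (by norm_num)
  have hsq : t₁ ^ 2 + t₂ ^ 2 ≤ T ^ 2 := by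
    have := mul_nonneg ht₁ ht₂
    rw [hT]; nlinarith
  have hcube : t₁ ^ 3 + t₂ ^ 3 ≤ T ^ 3 := by
    have h1 := mul_nonneg ht₁ ht₂
    have h2 := mul_nonneg h1 hT0
    rw [hT] at h2 ⊢; nlinarith
  have hC₁sq : C₁ * (t₁ ^ 2 + t₂ ^ 2) ≤ C₁ * T ^ 2 := by gcongr
  have hTk : T ≤ k * x ^ 4 := by
    have h1 : C₁ * T ^ 2 ≤ a / 2 * T := by
      calc C₁ * T ^ 2 = C₁ * T * T := by ring
        _ ≤ a / 2 * T := by gcongr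
    have h2 : (C₁ + C₂) * x ^ 6 ≤ (C₁ + C₂) * x ^ 4 := by gcongr
    have h3 : a * T ≤ 4 * (1 + C₁ + C₂) * x ^ 4 := by linarith
    rw [hk, div_mul_eq_mul_div, div_mul_eq_mul_div, le_div_iff₀ ha]
    linarith
  have haT : a * T ≤ 2 * x ^ 4 + (C₁ * k ^ 2 + 2 * C₁ + 2 * C₂) * x ^ 6 := by
    have h1 : C₁ * T ^ 2 ≤ C₁ * (k ^ 2 * x ^ 6) := by
      gcongr
      calc T ^ 2 ≤ (k * x ^ 4) ^ 2 := by gcongr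
        _ = k ^ 2 * x ^ 8 := by ring
        _ ≤ k ^ 2 * x ^ 6 := by gcongr
    linarith
  have hdT : d / 2 * T ≤ d / a * x ^ 4
      + d / (2 * a) * (C₁ * k ^ 2 + 2 * C₁ + 2 * C₂) * x ^ 6 := by
    calc d / 2 * T = d / (2 * a) * (a * T) := by field_simp
      _ ≤ d / (2 * a) * (2 * x ^ 4 + (C₁ * k ^ 2 + 2 * C₁ + 2 * C₂) * x ^ 6) := by gcongr
      _ = _ := by field_simp
  have hr : C₅ * (T * x ^ 9 + T ^ 2 * x ^ 6 + T ^ 3) ≤ C₅ * (k + k ^ 2 + k ^ 3) * x ^ 12 := by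
    rw [mul_assoc]
    refine mul_le_mul_of_nonneg_left ?_ hC₅
    have h1 : T * x ^ 9 ≤ k * x ^ 12 := by
      calc T * x ^ 9 ≤ k * x ^ 4 * x ^ 9 := by gcongr
        _ = k * x ^ 13 := by ring
        _ ≤ k * x ^ 12 := mul_le_mul_of_nonneg_left
          (pow_le_pow_of_le_one hx.le hx1 (by norm_num)) hk0
    have h2 : T ^ 2 * x ^ 6 ≤ k ^ 2 * x ^ 12 := by
      calc T ^ 2 * x ^ 6 ≤ (k * x ^ 4) ^ 2 * x ^ 6 := by gcongr
        _ = k ^ 2 * x ^ 14 := by ring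
        _ ≤ k ^ 2 * x ^ 12 := mul_le_mul_of_nonneg_left
          (pow_le_pow_of_le_one hx.le hx1 (by norm_num)) (by positivity)
    have h3 : T ^ 3 ≤ k ^ 3 * x ^ 12 := by
      calc T ^ 3 ≤ (k * x ^ 4) ^ 3 := by gcongr
        _ = k ^ 3 * x ^ 12 := by ring
    linarith
  have hsum : C₅ * (T * x ^ 9 + (t₁ ^ 2 + t₂ ^ 2) * x ^ 6 + (t₁ ^ 3 + t₂ ^ 3)) ≤
      C₅ * (T * x ^ 9 + T ^ 2 * x ^ 6 + T ^ 3) := by gcongr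
  have hx6 : 0 < x ^ 6 := by positivity
  have hfin : c * x ^ 6 ≤ (d / 2 * T + (C₄ + C₅ * (k + k ^ 2 + k ^ 3)) * x ^ 6) * x ^ 6 := by
    rw [hT] at hsum hr ⊢
    linarith
  have := le_of_mul_le_mul_right hfin hx6
  linarith

namespace Admissible

variable {n : ℕ} {u v : SpaceTime n → ℝ}

lemma second_horizontal_nonneg (H : Admissible u v) (h1 : dirDeriv (timeDir n) u 0 = 0)
    {z : EuclideanSpace ℝ (Fin n)} (hz : ‖z‖ ≤ 1) :
    0 ≤ dirDeriv (pt 0 z) (dirDeriv (pt 0 z) (dirDeriv (timeDir n) u)) 0 := by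
  have hut := contDiffOn_dirDeriv H.smooth_u (timeDir n)
  have hmem : ∀ h ∈ Icc (-1 : ℝ) 1, (0 : SpaceTime n) + h • pt 0 z ∈ closure (domainΩ n) :=
    fun h hh => by
      rw [zero_add, smul_pt, mul_zero]
      refine pt_mem_closure le_rfl zero_le_one ?_
      rw [norm_smul, Real.norm_eq_abs]
      exact mul_le_one₀ (abs_le.2 hh) (norm_nonneg _) hz
  have hI : ∀ᶠ h in 𝓝 (0 : ℝ), h ∈ Ioo (-1 : ℝ) 1 := Ioo_mem_nhds (by norm_num) (by norm_num)
  have hD : ∀ w : SpaceTime n → ℝ, ContDiffOn ℝ ∞ w (closure (domainΩ n)) → ∀ h ∈ Ioo (-1 : ℝ) 1,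
      HasDerivAt (fun h : ℝ => w ((0 : SpaceTime n) + h • pt 0 z))
        (dirDeriv (pt 0 z) w ((0 : SpaceTime n) + h • pt 0 z)) h := fun w hw h hh =>
    (hasDerivWithinAt_line hw hmem (Ioo_subset_Icc_self hh)).hasDerivAt (Icc_mem_nhds hh.1 hh.2)
  have hmin : IsLocalMin
      (fun h : ℝ => dirDeriv (timeDir n) u ((0 : SpaceTime n) + h • pt 0 z)) 0 := by
    filter_upwards [hI] with h hh
    rw [zero_smul, add_zero, h1]
    exact H.ut_nonneg (hmem h (Ioo_subset_Icc_self hh))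
  have h2 := hD _ (contDiffOn_dirDeriv hut (pt 0 z)) 0 (by norm_num)
  have h3 := hmin.second_deriv_nonneg (hI.mono fun h hh => hD _ hut h hh) h2
  simpa using h3

/-- Upper bound for `u` on a horizontal line, when `∂ₜ u` and `∂ₜ² u` vanish at the origin together
with the horizontal gradient of `∂ₜ² u`. -/
lemma exists_le_time_mul (H : Admissible u v) (h1 : dirDeriv (timeDir n) u 0 = 0)
    (h2 : dirDeriv (timeDir n) (dirDeriv (timeDir n) u) 0 = 0)
    (h2' : ∀ z, dirDeriv (pt 0 z) (dirDeriv (timeDir n) (dirDeriv (timeDir n) u)) 0 = 0)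
    {z : EuclideanSpace ℝ (Fin n)} (hz : ‖z‖ ≤ 1) :
    ∃ C, 0 ≤ C ∧ ∀ t h : ℝ, 0 ≤ t → t ≤ 1 → 0 ≤ h → h < 1 → u (pt t (h • z)) ≤
      t * (dirDeriv (pt 0 z) (dirDeriv (pt 0 z) (dirDeriv (timeDir n) u)) 0 / 2 * h ^ 2
        + C * (h ^ 3 + t * h ^ 2 + t ^ 2)) := by
  have hut := contDiffOn_dirDeriv H.smooth_u (timeDir n)
  have hutt := contDiffOn_dirDeriv hut (timeDir n)
  obtain ⟨C₁, hC₁, hC₁le⟩ := exists_second_order_le hut (pt 0 z)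
  obtain ⟨C₂, hC₂, hC₂le⟩ := exists_taylor_bound hut
  obtain ⟨C₃, hC₃, hC₃le⟩ := exists_taylor_bound hutt
  refine ⟨C₁ + C₂ + C₃, by positivity, fun t h ht0 ht1 hh0 hh1 => ?_⟩
  set D := dirDeriv (pt 0 z) (dirDeriv (pt 0 z) (dirDeriv (timeDir n) u)) 0
  have hnz : ∀ r : ℝ, 0 ≤ r → r ≤ 1 → ‖r • z‖ ≤ r := fun r h0 _ => by
    rw [norm_smul, Real.norm_of_nonneg h0]
    exact mul_le_of_le_one_right h0 hz
  have hhz := hnz h hh0 hh1.le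
  have hp0 : pt 0 (h • z) ∈ closure (domainΩ n) :=
    pt_mem_closure le_rfl zero_le_one (hhz.trans hh1.le)
  -- `∂ₜ u` at time `0`
  have e1 : dirDeriv (timeDir n) u (pt 0 (h • z)) ≤ D / 2 * h ^ 2 + C₁ * h ^ 3 := by
    have := hC₁le 0 (fun r hr => by
      rw [zero_add, smul_pt, mul_zero]
      exact pt_mem_closure le_rfl zero_le_one ((hnz r hr.1 hr.2).trans hr.2)) h ⟨hh0, hh1.le⟩
    rw [zero_add, smul_pt, mul_zero, h1,
      dirDeriv_slice_of_nonneg hut (fun p hp => H.ut_nonneg hp) h1] at this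
    linarith
  -- `∂ₜ² u` at time `0`
  have e2 : dirDeriv (timeDir n) (dirDeriv (timeDir n) u) (pt 0 (h • z)) ≤ C₃ * h ^ 2 := by
    have := (abs_le.1 (hC₃le 0 (zero_mem_closure n) _ hp0)).2
    rw [sub_zero, h2, h2', norm_sq_spaceTime, pt_fst, pt_snd] at this
    have h3 : ‖h • z‖ ^ 2 ≤ h ^ 2 := by gcongr
    have h4 : C₃ * (0 ^ 2 + ‖h • z‖ ^ 2) ≤ C₃ * h ^ 2 := by gcongr; linarith
    linarith
  have e3 : ∀ τ ∈ Icc 0 t, dirDeriv (timeDir n) u (pt τ (h • z)) ≤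
      D / 2 * h ^ 2 + (C₁ + C₂ + C₃) * (h ^ 3 + t * h ^ 2 + t ^ 2) := fun τ hτ => by
    have := (abs_le.1 (hC₂le _ hp0 _ (pt_mem_closure hτ.1 (hτ.2.trans ht1)
      (hhz.trans hh1.le)))).2
    have e4 : pt τ (h • z) - pt 0 (h • z) = τ • timeDir n := by
      simp [pt_sub, timeDir, smul_pt]
    rw [e4, dirDeriv_smul_dir, norm_smul, norm_timeDir, mul_one, Real.norm_of_nonneg hτ.1] at this
    have e5 : τ * dirDeriv (timeDir n) (dirDeriv (timeDir n) u) (pt 0 (h • z)) ≤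
        t * (C₃ * h ^ 2) :=
      (mul_le_mul_of_nonneg_left e2 hτ.1).trans
        (mul_le_mul_of_nonneg_right hτ.2 (by positivity))
    have e6 : C₂ * τ ^ 2 ≤ C₂ * t ^ 2 := by gcongr; exacts [hτ.1, hτ.2]
    have e7 : 0 ≤ C₁ * (t * h ^ 2 + t ^ 2) + C₂ * (h ^ 3 + t * h ^ 2) + C₃ * (h ^ 3 + t ^ 2) := by
      positivity
    linarith
  set M := D / 2 * h ^ 2 + (C₁ + C₂ + C₃) * (h ^ 3 + t * h ^ 2 + t ^ 2)
  have hlin : ∀ τ : ℝ, HasDerivAt (fun τ : ℝ => τ * M) M τ := fun τ => by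
    simpa using (hasDerivAt_id τ).mul_const M
  exact le_of_hasDerivWithinAt_le (b := t)
    (fun τ hτ => (hasDerivWithinAt_time H.smooth_u (hhz.trans hh1.le)
      ⟨hτ.1, hτ.2.trans ht1⟩).mono (Icc_subset_Icc_right ht1))
    (fun τ _ => (hlin τ).hasDerivWithinAt)
    (by rw [H.u_zero _ (hhz.trans_lt hh1), zero_mul]) e3 t ⟨ht0, le_rfl⟩

end Admissible

lemma tendsto_time {n : ℕ} {w : SpaceTime n → ℝ} (hw : ContDiffOn ℝ ∞ w (closure (domainΩ n))) :
    Tendsto (fun s : ℝ => w (pt s 0)) (𝓝[>] 0) (𝓝 (w 0)) := by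
  have := (hasDerivWithinAt_time hw (y := 0) (by simp)
    (left_mem_Icc.2 zero_le_one)).continuousWithinAt.tendsto
  exact this.mono_left (nhdsWithin_le_of_mem (Icc_mem_nhdsGT zero_lt_one))

namespace Admissible

variable {n : ℕ} {u v : SpaceTime n → ℝ}

lemma v_nonneg (H : Admissible u v) {p : SpaceTime n} (hp : p ∈ closure (domainΩ n)) : 0 ≤ v p :=
  ((H.smooth_v.continuousOn.preimage_isClosed_of_isClosed isClosed_closure
    (isClosed_Ici (a := (0 : ℝ)))).closure_subset_iff.2
    (fun q hq => ⟨subset_closure hq, (H.v_pos q hq).le⟩) hp).2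

lemma le_closure (H : Admissible u v) {p : SpaceTime n} (hp : p ∈ closure (domainΩ n)) :
    v p ≤ u p := by
  have := (((H.smooth_u.continuousOn.sub H.smooth_v.continuousOn).preimage_isClosed_of_isClosed
    isClosed_closure (isClosed_Ici (a := (0 : ℝ)))).closure_subset_iff.2
    (fun q hq => ⟨subset_closure hq, sub_nonneg.2 (H.le q hq)⟩) hp).2
  exact sub_nonneg.1 this

lemma v_zero (H : Admissible u v) (y : EuclideanSpace ℝ (Fin n)) (hy : ‖y‖ < 1) :
    v (pt 0 y) = 0 := by
  have hp : pt 0 y ∈ closure (domainΩ n) := pt_mem_closure le_rfl zero_le_one hy.le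
  exact le_antisymm ((H.le_closure hp).trans_eq (H.u_zero y hy)) (H.v_nonneg hp)

/-- Expansion at the origin of the Laplacian of `u`. -/
lemma exists_closedLaplacian_ge (H : Admissible u v)
    (h2 : dirDeriv (timeDir n) (dirDeriv (timeDir n) u) 0 = 0)
    (h2' : ∀ z, dirDeriv (pt 0 z) (dirDeriv (timeDir n) (dirDeriv (timeDir n) u)) 0 = 0) :
    ∃ C, 0 ≤ C ∧ ∀ (t : ℝ) (y : EuclideanSpace ℝ (Fin n)), 0 ≤ t → t ≤ 1 → ‖y‖ ≤ 1 →
      (dirDeriv (timeDir n) (dirDeriv (timeDir n) (dirDeriv (timeDir n) u)) 0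
        + ∑ i, dirDeriv (pt 0 (EuclideanSpace.single i 1))
          (dirDeriv (pt 0 (EuclideanSpace.single i 1)) (dirDeriv (timeDir n) u)) 0) * t
        - C * (t ^ 2 + ‖y‖ ^ 2) ≤ closedLaplacian u (pt t y) := by
  have hu := H.smooth_u
  have h0 := zero_mem_closure n
  obtain ⟨C, hC, hCle⟩ := exists_taylor_bound (contDiffOn_closedLaplacian hu)
  refine ⟨C, hC, fun t y ht0 ht1 hy => ?_⟩
  have h3 := (abs_le.1 (hCle 0 h0 _ (pt_mem_closure ht0 ht1 hy))).1
  have e0 : closedLaplacian u 0 = 0 := by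
    have := closedLaplacian_slice hu H.u_zero (y := 0) (by simp)
    rwa [pt_zero_zero, h2] at this
  have e1 : dirDeriv (pt 0 y) (closedLaplacian u) 0 = 0 := by
    rw [dirDeriv_closedLaplacian hu h0, h2', Finset.sum_eq_zero, add_zero]
    intro i _
    have hui := contDiffOn_dirDeriv (contDiffOn_dirDeriv hu (pt 0 (EuclideanSpace.single i 1)))
      (pt 0 (EuclideanSpace.single i 1))
    refine dirDeriv_slice_eq_zero (y := 0) hui (fun z hz => ?_) (by simp) y
    exact dirDeriv_slice_eq_zero (contDiffOn_dirDeriv hu _)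
      (fun z hz => dirDeriv_slice_eq_zero hu H.u_zero hz _) hz _
  have e2 : ∀ e : SpaceTime n, dirDeriv (timeDir n) (dirDeriv e (dirDeriv e u)) 0
      = dirDeriv e (dirDeriv e (dirDeriv (timeDir n) u)) 0 := fun e => by
    rw [dirDeriv_comm (contDiffOn_dirDeriv hu e) h0]
    exact dirDeriv_congr (fun p hp => dirDeriv_comm hu hp _ _) h0 _
  rw [sub_zero, pt_eq_add, dirDeriv_add_dir, dirDeriv_smul_dir, e1,
    dirDeriv_closedLaplacian hu h0, ← pt_eq_add, norm_sq_spaceTime, pt_fst, pt_snd, e0] at h3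
  simp only [e2 (pt 0 _)] at h3
  linarith

/-- Bound for the second derivative of `v` in a coordinate direction by the Laplacian of `v`, on
the time axis. The main condition is used at the two points at distance `η = Λ ^ (3 / 4)` from the
axis in that direction, where `Λ` is the Laplacian. At these points `u` takes the value of `v` at
times `t` of order `Λ`; hence the term `t η²` of `u` dominates `t³`, while errors of order `η²`
in the Laplacians are negligible against `Λ`. -/
lemma eventually_second_deriv_le (H : Admissible u v) (h1 : dirDeriv (timeDir n) u 0 = 0)
    (h2 : dirDeriv (timeDir n) (dirDeriv (timeDir n) u) 0 = 0)
    (h2' : ∀ z, dirDeriv (pt 0 z) (dirDeriv (timeDir n) (dirDeriv (timeDir n) u)) 0 = 0)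
    (hv2 : dirDeriv (timeDir n) (dirDeriv (timeDir n) v) 0 = 0) {a : ℝ} (ha : 0 < a)
    (haeq : a = dirDeriv (timeDir n) (dirDeriv (timeDir n) (dirDeriv (timeDir n) u)) 0
        + ∑ i, dirDeriv (pt 0 (EuclideanSpace.single i 1))
          (dirDeriv (pt 0 (EuclideanSpace.single i 1)) (dirDeriv (timeDir n) u)) 0) (i : Fin n) :
    ∃ C, ∀ᶠ s in 𝓝[>] (0 : ℝ), 0 < closedLaplacian v (pt s 0) →
      dirDeriv (pt 0 (EuclideanSpace.single i 1))
        (dirDeriv (pt 0 (EuclideanSpace.single i 1)) v) (pt s 0) ≤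
      dirDeriv (pt 0 (EuclideanSpace.single i 1))
        (dirDeriv (pt 0 (EuclideanSpace.single i 1)) (dirDeriv (timeDir n) u)) 0 / a *
          closedLaplacian v (pt s 0) + C * √(closedLaplacian v (pt s 0)) ^ 3 := by
  set z : EuclideanSpace ℝ (Fin n) := EuclideanSpace.single i 1 with hzdef
  have hz : ‖z‖ = 1 := by simp [hzdef]
  have hnz : pt 0 (-z) = -pt 0 z := by
    rw [← sub_eq_zero, sub_neg_eq_add, pt_add]; simp
  have hut := contDiffOn_dirDeriv H.smooth_u (timeDir n)
  have h0 := zero_mem_closure n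
  set d := dirDeriv (pt 0 z) (dirDeriv (pt 0 z) (dirDeriv (timeDir n) u)) 0 with hd
  have hd0 : 0 ≤ d := H.second_horizontal_nonneg h1 hz.le
  obtain ⟨C₁, hC₁, hC₁le⟩ := H.exists_closedLaplacian_ge h2 h2'
  obtain ⟨C₂, hC₂, hC₂le⟩ := exists_symmetric_le (contDiffOn_closedLaplacian H.smooth_v)
  obtain ⟨C₄, hC₄, hC₄le⟩ := exists_symmetric_ge H.smooth_v (pt 0 z)
  obtain ⟨C₅, hC₅, hC₅le⟩ := H.exists_le_time_mul h1 h2 h2' hz.le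
  obtain ⟨C₆, hC₆, hC₆le⟩ := H.exists_le_time_mul h1 h2 h2' (z := -z) (by rw [norm_neg, hz])
  rw [hnz, dirDeriv_neg_neg hut _ h0, ← hd] at hC₆le
  rw [← haeq] at hC₁le
  refine ⟨d / (2 * a) * (C₁ * (4 / a * (1 + C₁ + C₂)) ^ 2 + 2 * C₁ + 2 * C₂) + C₄ + (C₅ + C₆) *
    (4 / a * (1 + C₁ + C₂) + (4 / a * (1 + C₁ + C₂)) ^ 2 + (4 / a * (1 + C₁ + C₂)) ^ 3), ?_⟩
  have hΛ0 : closedLaplacian v 0 = 0 := by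
    have := closedLaplacian_slice H.smooth_v H.v_zero (y := 0) (by simp)
    rwa [pt_zero_zero, hv2] at this
  have hΛ := tendsto_time (contDiffOn_closedLaplacian H.smooth_v)
  rw [hΛ0] at hΛ
  filter_upwards [hΛ.eventually_lt_const zero_lt_one,
    Ioo_mem_nhdsGT (show (0 : ℝ) < min 1 (a / (4 * (C₁ + 1))) by positivity)] with s hs1 hs hpos
  set Λ := closedLaplacian v (pt s 0)
  have hs0 : 0 < s := hs.1
  have hsl : s < 1 := hs.2.trans_le (min_le_left _ _)
  have hsa : C₁ * s ≤ a / 4 := by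
    have : s ≤ a / (4 * (C₁ + 1)) := (hs.2.trans_le (min_le_right _ _)).le
    rw [le_div_iff₀ (by positivity)] at this
    linarith
  set x := √√Λ with hx
  have hx0 : 0 < x := Real.sqrt_pos.2 (Real.sqrt_pos.2 hpos)
  have hx2 : x ^ 2 = √Λ := Real.sq_sqrt (Real.sqrt_nonneg _)
  have hx4 : x ^ 4 = Λ := by
    rw [show x ^ 4 = (x ^ 2) ^ 2 by ring, hx2, Real.sq_sqrt hpos.le]
  have hx6 : x ^ 6 = √Λ ^ 3 := by rw [← hx2]; ring
  have hx1 : x < 1 := by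
    by_contra! h
    have := one_le_pow₀ h (n := 4)
    linarith
  have hh0 : 0 ≤ x ^ 3 := by positivity
  have hh1 : x ^ 3 < 1 := pow_lt_one₀ hx0.le hx1 (by norm_num)
  have hhz : ‖x ^ 3 • z‖ = x ^ 3 := by rw [norm_smul, hz, mul_one, Real.norm_of_nonneg hh0]
  have hhz' : ‖x ^ 3 • -z‖ = x ^ 3 := by rw [smul_neg, norm_neg, hhz]
  -- the main condition at a point at distance `x ^ 3` from the axis
  have hlevel : ∀ y : EuclideanSpace ℝ (Fin n), ‖y‖ = x ^ 3 → ∃ t, 0 ≤ t ∧ t ≤ s ∧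
      u (pt t y) = v (pt s y) ∧
      a * t - C₁ * (t ^ 2 + x ^ 6) ≤ closedLaplacian v (pt s y) := by
    intro y hy
    have hyl : ‖y‖ < 1 := hy ▸ hh1
    have hp : pt s y ∈ domainΩ n := ⟨hs0, hsl, hyl⟩
    obtain ⟨t, ht, hlev⟩ := H.exists_level hp
    refine ⟨t, ht.1.le, ht.2, hlev, ?_⟩
    have hts : t < 1 := lt_of_le_of_lt ht.2 hsl
    have hm := H.main t s y ht.1 ht.2 hsl hyl hlev
    rw [laplacian_eq_closedLaplacian H.smooth_u (p := pt t y) ⟨ht.1, hts, hyl⟩,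
      laplacian_eq_closedLaplacian H.smooth_v hp] at hm
    have := hC₁le t y ht.1.le hts.le hyl.le
    rw [hy, show (x ^ 3) ^ 2 = x ^ 6 by ring] at this
    linarith
  obtain ⟨t₁, ht₁, hts₁, hlev₁, hm₁⟩ := hlevel _ hhz
  obtain ⟨t₂, ht₂, hts₂, hlev₂, hm₂⟩ := hlevel _ hhz'
  have hlap := hC₂le s (x ^ 3 • z) hs0.le hsl.le (hhz.trans_le hh1.le)
  rw [← smul_neg, hhz, show (x ^ 3) ^ 2 = x ^ 6 by ring] at hlap
  have hmem : ∀ z' : EuclideanSpace ℝ (Fin n), ‖z'‖ = 1 → ∀ h ∈ Icc (0 : ℝ) 1,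
      pt s (0 : EuclideanSpace ℝ (Fin n)) + h • pt 0 z' ∈ closure (domainΩ n) :=
    fun z' hz' h hh => by
      rw [smul_pt, pt_add, mul_zero, add_zero, zero_add]
      refine pt_mem_closure hs0.le hsl.le ?_
      rw [norm_smul, hz', mul_one, Real.norm_of_nonneg hh.1]
      exact hh.2
  have hsym := hC₄le (pt s 0) (hmem z hz)
    (by rw [← hnz]; exact hmem (-z) (by rw [norm_neg, hz])) (x ^ 3) ⟨hh0, hh1.le⟩
  rw [← hnz, smul_pt, smul_pt, pt_add, pt_add, mul_zero, add_zero, zero_add, zero_add,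
    ← hlev₁, ← hlev₂] at hsym
  have hv0 := H.v_nonneg (pt_mem_closure hs0.le hsl.le
    (by simp : ‖(0 : EuclideanSpace ℝ (Fin n))‖ ≤ 1))
  have hu₁ := hC₅le t₁ (x ^ 3) ht₁ (hts₁.trans hsl.le) hh0 hh1
  have hu₂ := hC₆le t₂ (x ^ 3) ht₂ (hts₂.trans hsl.le) hh0 hh1
  have hx9 : (x ^ 3) ^ 3 = x ^ 9 := by ring
  have hx36 : (x ^ 3) ^ 2 = x ^ 6 := by ring
  have hx12 : (x ^ 3) ^ 4 = x ^ 12 := by ring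
  rw [hx9, hx36] at hu₁ hu₂
  rw [hx36, hx12] at hsym
  have hw₁ : t₁ * (d / 2 * x ^ 6 + C₅ * (x ^ 9 + t₁ * x ^ 6 + t₁ ^ 2)) ≤
      t₁ * (d / 2 * x ^ 6 + (C₅ + C₆) * (x ^ 9 + t₁ * x ^ 6 + t₁ ^ 2)) := by
    gcongr; linarith
  have hw₂ : t₂ * (d / 2 * x ^ 6 + C₆ * (x ^ 9 + t₂ * x ^ 6 + t₂ ^ 2)) ≤
      t₂ * (d / 2 * x ^ 6 + (C₅ + C₆) * (x ^ 9 + t₂ * x ^ 6 + t₂ ^ 2)) := by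
    gcongr; linarith
  rw [← hx6, ← hx4]
  refine averaging_arithmetic hx0 hx1.le ht₁ ht₂ ha hd0 hC₁ hC₂ (by positivity) rfl ?_ ?_ ?_
  · rw [hx4]; linarith
  · have e1 : C₁ * t₁ ≤ C₁ * s := by gcongr
    have e2 : C₁ * t₂ ≤ C₁ * s := by gcongr
    linarith
  · linarith

/-- On the time axis, the second time derivative of `v` at time `s` controls the time `t` at which
`u` takes the value that `v` takes at time `s`: asymptotically, `∂ₜ³ u (0, 0) t ≤ ∂ₜ² v (s, 0)`.
The purely spatial second derivatives have been eliminated by summing over the directions. -/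
theorem eventually_mul_le_second_deriv (H : Admissible u v) (h1 : dirDeriv (timeDir n) u 0 = 0)
    (h2 : dirDeriv (timeDir n) (dirDeriv (timeDir n) u) 0 = 0)
    (h2' : ∀ z, dirDeriv (pt 0 z) (dirDeriv (timeDir n) (dirDeriv (timeDir n) u)) 0 = 0)
    (h3 : 0 < dirDeriv (timeDir n) (dirDeriv (timeDir n) (dirDeriv (timeDir n) u)) 0)
    (hv2 : dirDeriv (timeDir n) (dirDeriv (timeDir n) v) 0 = 0) {θ : ℝ} (hθ : 0 < θ)
    (hθ1 : θ < 1) :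
    ∀ᶠ s in 𝓝[>] (0 : ℝ), ∀ t, 0 < t → t ≤ s → u (pt t 0) = v (pt s 0) →
      (1 - θ) ^ 2 * dirDeriv (timeDir n) (dirDeriv (timeDir n) (dirDeriv (timeDir n) u)) 0 * t ≤
        dirDeriv (timeDir n) (dirDeriv (timeDir n) v) (pt s 0) := by
  set g := dirDeriv (timeDir n) (dirDeriv (timeDir n) (dirDeriv (timeDir n) u)) 0
  set d : Fin n → ℝ := fun i => dirDeriv (pt 0 (EuclideanSpace.single i 1))
    (dirDeriv (pt 0 (EuclideanSpace.single i 1)) (dirDeriv (timeDir n) u)) 0 with hd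
  have hd0 : ∀ i, 0 ≤ d i := fun i => H.second_horizontal_nonneg h1 (by simp)
  set a : ℝ := g + ∑ i, d i with haeq
  have ha : 0 < a := add_pos_of_pos_of_nonneg h3 (Finset.sum_nonneg fun i _ => hd0 i)
  choose C hC using fun i => H.eventually_second_deriv_le h1 h2 h2' hv2 ha haeq i
  obtain ⟨C₁, hC₁, hC₁le⟩ := H.exists_closedLaplacian_ge h2 h2'
  have hΛ0 : closedLaplacian v 0 = 0 := by
    have := closedLaplacian_slice H.smooth_v H.v_zero (y := 0) (by simp)
    rwa [pt_zero_zero, hv2] at this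
  have hΛ := tendsto_time (contDiffOn_closedLaplacian H.smooth_v)
  rw [hΛ0] at hΛ
  have hsqrt : Tendsto (fun s : ℝ => (∑ i, C i) * √(closedLaplacian v (pt s 0)))
      (𝓝[>] 0) (𝓝 0) := by
    have := ((Real.continuous_sqrt.tendsto 0).comp hΛ).const_mul (∑ i, C i)
    simpa using this
  have hsmall : (0 : ℝ) < θ * (g / a) := by positivity
  filter_upwards [eventually_all.2 hC, hsqrt.eventually_lt_const hsmall,
    Ioo_mem_nhdsGT (show (0 : ℝ) < min 1 (θ * a / (C₁ + 1)) by positivity)]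
    with s hs hsq hss t ht hts hlev
  set Λ := closedLaplacian v (pt s 0) with hΛdef
  have hsl : s < 1 := hss.2.trans_le (min_le_left _ _)
  have hy0 : ‖(0 : EuclideanSpace ℝ (Fin n))‖ < 1 := by simp
  have hta : C₁ * t ≤ θ * a := by
    have : s ≤ θ * a / (C₁ + 1) := (hss.2.trans_le (min_le_right _ _)).le
    rw [le_div_iff₀ (by positivity)] at this
    have h4 : C₁ * t ≤ C₁ * s := by gcongr
    have := hss.1
    linarith
  have hlow : (1 - θ) * a * t ≤ Λ := by
    have hm := H.main t s 0 ht hts hsl hy0 hlev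
    rw [laplacian_eq_closedLaplacian H.smooth_u (p := pt t 0) ⟨ht, hts.trans_lt hsl, hy0⟩,
      laplacian_eq_closedLaplacian H.smooth_v (p := pt s 0) ⟨hss.1, hsl, hy0⟩] at hm
    have h4 := hC₁le t 0 ht.le (hts.trans hsl.le) hy0.le
    rw [norm_zero] at h4
    have h5 : C₁ * t * t ≤ θ * a * t := by gcongr
    have h6 : a * t - C₁ * (t ^ 2 + 0 ^ 2) ≤ Λ := h4.trans hm
    linarith
  have hΛpos : 0 < Λ := lt_of_lt_of_le (mul_pos (mul_pos (by linarith) ha) ht) hlow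
  have hsum := Finset.sum_le_sum fun i (_ : i ∈ Finset.univ) => hs i hΛpos
  rw [Finset.sum_add_distrib, ← Finset.sum_mul, ← Finset.sum_mul, ← Finset.sum_div] at hsum
  have hsplit : Λ = dirDeriv (timeDir n) (dirDeriv (timeDir n) v) (pt s 0) +
      ∑ i, dirDeriv (pt 0 (EuclideanSpace.single i 1))
        (dirDeriv (pt 0 (EuclideanSpace.single i 1)) v) (pt s 0) := rfl
  have hcube : (∑ i, C i) * √Λ ^ 3 ≤ θ * (g / a) * Λ := by
    have e : (∑ i, C i) * √Λ ^ 3 = (∑ i, C i) * √Λ * Λ := by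
      rw [show √Λ ^ 3 = √Λ * √Λ ^ 2 by ring, Real.sq_sqrt hΛpos.le]; ring
    rw [e]
    gcongr
  have hga : (∑ i, d i) / a = 1 - g / a := by
    rw [eq_sub_iff_add_eq, ← add_div, add_comm, ← haeq, div_self ha.ne']
  have hup : (1 - θ) * (g / a) * Λ ≤ dirDeriv (timeDir n) (dirDeriv (timeDir n) v) (pt s 0) := by
    have : (∑ i, d i) / a * Λ = Λ - g / a * Λ := by rw [hga]; ring
    simp only [hd] at this
    linarith
  refine le_trans ?_ hup
  calc (1 - θ) ^ 2 * g * t = (1 - θ) * (g / a) * ((1 - θ) * a * t) := by field_simp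
    _ ≤ (1 - θ) * (g / a) * Λ := by
      have : 0 ≤ (1 - θ) * (g / a) := mul_nonneg (by linarith) (by positivity)
      gcongr

end Admissible

/-! ### Vanishing orders on the time axis and conclusion -/

namespace Admissible

variable {n : ℕ} {u v : SpaceTime n → ℝ}

lemma pt_mem {s : ℝ} (hs : s ∈ Ioo (0 : ℝ) 1) : pt s (0 : EuclideanSpace ℝ (Fin n)) ∈ domainΩ n :=
  ⟨hs.1, hs.2, by simp⟩

/-- A choice, for each `s`, of the time at which `u` takes the value `v (s, 0)` on the axis. -/
lemma exists_level_fun (H : Admissible u v) : ∃ T : ℝ → ℝ,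
    (∀ s ∈ Ioo (0 : ℝ) 1, 0 < T s ∧ T s ≤ s ∧ u (pt (T s) 0) = v (pt s 0)) ∧
    Tendsto T (𝓝[>] 0) (𝓝[>] 0) := by
  have hex : ∀ s : ℝ, ∃ t, s ∈ Ioo (0 : ℝ) 1 → 0 < t ∧ t ≤ s ∧ u (pt t 0) = v (pt s 0) := by
    intro s
    by_cases hs : s ∈ Ioo (0 : ℝ) 1
    · obtain ⟨t, ht, h⟩ := H.exists_level (pt_mem hs)
      exact ⟨t, fun _ => ⟨ht.1, ht.2, h⟩⟩
    · exact ⟨0, fun h => absurd h hs⟩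
  choose T hT using hex
  refine ⟨T, hT, tendsto_nhdsWithin_iff.2 ⟨?_, ?_⟩⟩
  · have hid : Tendsto (fun s : ℝ => s) (𝓝[>] 0) (𝓝 0) := tendsto_id.mono_left nhdsWithin_le_nhds
    refine tendsto_of_tendsto_of_tendsto_of_le_of_le' tendsto_const_nhds hid ?_ ?_
    · filter_upwards [Ioo_mem_nhdsGT zero_lt_one] with s hs using (hT s hs).1.le
    · filter_upwards [Ioo_mem_nhdsGT zero_lt_one] with s hs using (hT s hs).2.1
  · filter_upwards [Ioo_mem_nhdsGT zero_lt_one] with s hs using (hT s hs).1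

/-- The leading coefficient of a function that is positive on the time axis is positive. -/
lemma _root_.leading_coeff_pos {w : SpaceTime n → ℝ}
    (hw : ContDiffOn ℝ ∞ w (closure (domainΩ n))) (hpos : ∀ p ∈ domainΩ n, 0 < w p) {m : ℕ}
    (h0 : ∀ i < m, (dirDeriv (timeDir n))^[i] w 0 = 0)
    (hm : (dirDeriv (timeDir n))^[m] w 0 ≠ 0) : 0 < (dirDeriv (timeDir n))^[m] w 0 := by
  refine lt_of_le_of_ne ?_ hm.symm
  have hlim := tendsto_time_div_pow hw h0
  have h1 : 0 ≤ (dirDeriv (timeDir n))^[m] w 0 / m.factorial := by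
    refine ge_of_tendsto hlim ?_
    filter_upwards [Ioo_mem_nhdsGT zero_lt_one] with s hs
    exact div_nonneg (hpos _ (pt_mem hs)).le (pow_nonneg hs.1.le _)
  have hf : (0 : ℝ) < m.factorial := by exact_mod_cast m.factorial_pos
  rwa [le_div_iff₀ hf, zero_mul] at h1

lemma u_pos (H : Admissible u v) {p : SpaceTime n} (hp : p ∈ domainΩ n) : 0 < u p :=
  (H.v_pos p hp).trans_le (H.le p hp)

/-- The vanishing order of `v` on the time axis is at least that of `u`. -/
lemma order_le (H : Admissible u v) {k l : ℕ}
    (hk : ∀ i < k, (dirDeriv (timeDir n))^[i] u 0 = 0)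
    (hl : ∀ i < l, (dirDeriv (timeDir n))^[i] v 0 = 0)
    (hl' : (dirDeriv (timeDir n))^[l] v 0 ≠ 0) : k ≤ l := by
  by_contra! hlt
  have hpos := leading_coeff_pos H.smooth_v H.v_pos hl hl'
  have h1 := tendsto_time_div_pow H.smooth_v hl
  have h2 := tendsto_time_div_pow H.smooth_u fun i (hi : i < l) => hk i (hi.trans hlt)
  rw [hk l hlt, zero_div] at h2
  have h3 := le_of_tendsto_of_tendsto h1 h2 (by
    filter_upwards [Ioo_mem_nhdsGT zero_lt_one] with s hs
    have := hs.1
    gcongr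
    exact H.le _ (pt_mem hs))
  have hf : (0 : ℝ) < l.factorial := by exact_mod_cast l.factorial_pos
  exact absurd h3 (not_le.2 (div_pos hpos hf))

/-- A linear lower bound for the time shift separates the leading coefficients of `u` and `v` on
the time axis. -/
lemma leading_coeff_le (H : Admissible u v) {ε h : ℝ} (hε0 : 0 < ε) (hε : ε < 1) (hh : 0 < h)
    (hshift : ∀ s, 0 < s → s < h → ∀ t, 0 ≤ t → t ≤ s →
      u (pt t 0) = v (pt s 0) → t ≤ (1 - ε) * s) {k : ℕ}
    (hk : ∀ i < k, (dirDeriv (timeDir n))^[i] u 0 = 0)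
    (hkv : ∀ i < k, (dirDeriv (timeDir n))^[i] v 0 = 0) :
    (dirDeriv (timeDir n))^[k] v 0 ≤ (1 - ε) ^ k * (dirDeriv (timeDir n))^[k] u 0 := by
  have hε' : 0 < 1 - ε := by linarith
  obtain ⟨T, hT, -⟩ := H.exists_level_fun
  have h1 := tendsto_time_div_pow H.smooth_v hkv
  have h2 := tendsto_time_div_pow H.smooth_u hk
  have hscale : Tendsto (fun s : ℝ => (1 - ε) * s) (𝓝[>] 0) (𝓝[>] 0) := by
    refine tendsto_nhdsWithin_iff.2 ⟨?_, ?_⟩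
    · have : Tendsto (fun s : ℝ => (1 - ε) * s) (𝓝 0) (𝓝 ((1 - ε) * 0)) :=
        (continuous_const.mul continuous_id).tendsto 0
      rw [mul_zero] at this
      exact this.mono_left nhdsWithin_le_nhds
    · filter_upwards [self_mem_nhdsWithin] with s hs using mul_pos hε' hs
  have h3 := (h2.comp hscale).const_mul ((1 - ε) ^ k)
  have h4 := le_of_tendsto_of_tendsto h1 h3 (by
    filter_upwards [Ioo_mem_nhdsGT (lt_min zero_lt_one hh)] with s hs
    have hs1 : s < 1 := hs.2.trans_le (min_le_left _ _)
    obtain ⟨hT0, hTs, hlev⟩ := hT s ⟨hs.1, hs1⟩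
    have hle := hshift s hs.1 (hs.2.trans_le (min_le_right _ _)) _ hT0.le hTs hlev
    have hmono : v (pt s 0) ≤ u (pt ((1 - ε) * s) 0) := by
      rw [← hlev]
      exact (H.strictMonoOn (y := 0) (by simp)).monotoneOn ⟨hT0.le, hTs.trans hs1.le⟩
        ⟨(mul_pos hε' hs.1).le, by nlinarith [hs.1]⟩ hle
    have hs0 : (0 : ℝ) < s ^ k := pow_pos hs.1 k
    have hε0 : (1 - ε) ^ k ≠ 0 := (pow_pos hε' k).ne'
    simp only [Function.comp_apply]
    rw [mul_pow, mul_div_assoc', mul_div_mul_left _ _ hε0]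
    gcongr)
  have hf : (0 : ℝ) < k.factorial := by exact_mod_cast k.factorial_pos
  rw [← mul_div_assoc] at h4
  exact (div_le_div_iff_of_pos_right hf).1 h4

/-- Vanishing order two: on the axis, the main condition gives `∂ₜ² u (0, 0) ≤ ∂ₜ² v (0, 0)` in the
limit, since all the other second derivatives vanish at time `0`; the Hopf lemma gives the strict
opposite inequality. -/
lemma second_order_impossible (H : Admissible u v) (hlt : ∀ p ∈ domainΩ n, v p < u p)
    (hk : ∀ i < 2, (dirDeriv (timeDir n))^[i] u 0 = 0)
    (hk' : (dirDeriv (timeDir n))^[2] u 0 ≠ 0)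
    (hkv : ∀ i < 2, (dirDeriv (timeDir n))^[i] v 0 = 0) : False := by
  have hpos := leading_coeff_pos H.smooth_u (fun p hp => H.u_pos hp) hk hk'
  have hutt := contDiffOn_dirDeriv (contDiffOn_dirDeriv H.smooth_u (timeDir n)) (timeDir n)
  set g := (dirDeriv (timeDir n))^[2] u 0 with hg
  obtain ⟨L, hL, hLle⟩ := exists_lipschitz_bound hutt
  obtain ⟨ε, hε0, hε1, h, hh, hshift⟩ := H.exists_shift_origin hlt (c := g / 2) (C := 0)
    (r := g / (2 * (L + 1))) (by positivity) le_rfl (by positivity) (fun p hp hpr => by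
      have h1 := (abs_le.1 (hLle 0 (zero_mem_closure n) p (subset_closure hp))).1
      rw [sub_zero] at h1
      rw [lt_div_iff₀ (by positivity)] at hpr
      have h2 : g / 2 * p.fst ≤ g / 2 := mul_le_of_le_one_right (by positivity) hp.2.1.le
      have h3 : dirDeriv (timeDir n) (dirDeriv (timeDir n) u) 0 = g := rfl
      have := norm_nonneg p
      linarith)
  have h1 := H.leading_coeff_le hε0 hε1 hh hshift hk hkv
  obtain ⟨T, hT, hTlim⟩ := H.exists_level_fun
  -- the main condition on the time axis, in the limit
  have h2 : closedLaplacian u 0 ≤ closedLaplacian v 0 := by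
    refine le_of_tendsto_of_tendsto
      ((tendsto_time (contDiffOn_closedLaplacian H.smooth_u)).comp hTlim)
      (tendsto_time (contDiffOn_closedLaplacian H.smooth_v)) ?_
    filter_upwards [Ioo_mem_nhdsGT zero_lt_one] with s hs
    obtain ⟨hT0, hTs, hlev⟩ := hT s hs
    have hm := H.main (T s) s 0 hT0 hTs hs.2 (by simp) hlev
    rwa [laplacian_eq_closedLaplacian H.smooth_u (pt_mem ⟨hT0, hTs.trans_lt hs.2⟩),
      laplacian_eq_closedLaplacian H.smooth_v (pt_mem hs)] at hm
  have e1 := closedLaplacian_slice H.smooth_u H.u_zero (y := 0) (by simp)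
  have e2 := closedLaplacian_slice H.smooth_v H.v_zero (y := 0) (by simp)
  rw [pt_zero_zero] at e1 e2
  rw [e1, e2] at h2
  have h3 : g ≤ (dirDeriv (timeDir n))^[2] v 0 := h2
  have h4 : (1 - ε) ^ 2 < 1 := pow_lt_one₀ (by linarith) (by linarith) two_ne_zero
  have h5 : (1 - ε) ^ 2 * g < g := mul_lt_of_lt_one_left hpos h4
  linarith

/-- Vanishing order three, with `v` vanishing to order `m + 3`: let `g` and `q` be the leading
derivatives of `u` and `v`. At corresponding times `t` and `s` on the axis, `t³ ∼ 6 v (s, 0) / g`,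
so the inequality `g t ≲ ∂ₜ² v (s, 0)` forces `m = 0` and `g ≤ q`, while the Hopf lemma gives
`q < g`. -/
lemma third_order_impossible (H : Admissible u v) (hlt : ∀ p ∈ domainΩ n, v p < u p)
    (hk : ∀ i < 3, (dirDeriv (timeDir n))^[i] u 0 = 0)
    (hk' : (dirDeriv (timeDir n))^[3] u 0 ≠ 0)
    (h2' : ∀ z, dirDeriv (pt 0 z) (dirDeriv (timeDir n) (dirDeriv (timeDir n) u)) 0 = 0)
    {m : ℕ} (hl : ∀ i < m + 3, (dirDeriv (timeDir n))^[i] v 0 = 0)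
    (hl' : (dirDeriv (timeDir n))^[m + 3] v 0 ≠ 0) : False := by
  have hpos := leading_coeff_pos H.smooth_u (fun p hp => H.u_pos hp) hk hk'
  have hvpos := leading_coeff_pos H.smooth_v H.v_pos hl hl'
  have hutt := contDiffOn_dirDeriv (contDiffOn_dirDeriv H.smooth_u (timeDir n)) (timeDir n)
  have hvtt := contDiffOn_dirDeriv (contDiffOn_dirDeriv H.smooth_v (timeDir n)) (timeDir n)
  have h1 : dirDeriv (timeDir n) u 0 = 0 := hk 1 (by norm_num)
  have h2 : dirDeriv (timeDir n) (dirDeriv (timeDir n) u) 0 = 0 := hk 2 (by norm_num)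
  have hv2 : dirDeriv (timeDir n) (dirDeriv (timeDir n) v) 0 = 0 := hl 2 (by omega)
  set g := (dirDeriv (timeDir n))^[3] u 0 with hg
  set q := (dirDeriv (timeDir n))^[m + 3] v 0 with hq
  obtain ⟨C, hC, hCle⟩ := exists_taylor_bound hutt
  obtain ⟨ε, hε0, hε1, h, hh, hshift⟩ := H.exists_shift_origin hlt (c := g / 2) (C := C)
    (r := g / (2 * (C + 1))) (by positivity) hC (by positivity) (fun p hp hpr => by
      have e1 := (abs_le.1 (hCle 0 (zero_mem_closure n) p (subset_closure hp))).1
      have e2 : dirDeriv p (dirDeriv (timeDir n) (dirDeriv (timeDir n) u)) 0 = p.fst * g := by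
        conv_lhs => rw [← pt_eta p, pt_eq_add]
        rw [dirDeriv_add_dir, dirDeriv_smul_dir, h2', add_zero]
        rfl
      rw [sub_zero, h2, e2] at e1
      rw [lt_div_iff₀ (by positivity)] at hpr
      have e3 := norm_sq_spaceTime p
      have e4 : p.fst ≤ ‖p‖ := by
        have := inner_timeDir p
        have e5 := real_inner_le_norm p (timeDir n)
        rw [norm_timeDir, mul_one] at e5
        linarith
      have e6 : p.fst * (2 * (C + 1)) ≤ g :=
        (mul_le_mul_of_nonneg_right e4 (by positivity)).trans hpr.le
      have e7 := mul_le_mul_of_nonneg_right e6 hp.1.le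
      rw [e3] at e1
      have := sq_nonneg p.fst
      linarith)
  obtain ⟨T, hT, hTlim⟩ := H.exists_level_fun
  set θ : ℝ := ε / 2 with hθ
  have hkey := H.eventually_mul_le_second_deriv h1 h2 h2' hpos hv2 (θ := θ) (by positivity)
    (by linarith)
  -- the cube of the inequality for `T`, divided by `s ^ (m + 3)`, in the limit
  have hlim1 := tendsto_time_div_pow H.smooth_v hl
  have hlim2 := (tendsto_time_div_pow H.smooth_u hk).comp hTlim
  have hlim3 := tendsto_time_div_pow hvtt (m := m + 1) fun i hi => hl (i + 2) (by omega)
  have hlim4 : Tendsto (fun s : ℝ => s ^ (2 * m)) (𝓝[>] 0) (𝓝 (0 ^ (2 * m))) :=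
    ((continuous_pow (2 * m)).tendsto 0).mono_left nhdsWithin_le_nhds
  have hlim := le_of_tendsto_of_tendsto (hlim1.const_mul (((1 - θ) ^ 2 * g) ^ 3))
    ((hlim2.mul (hlim3.pow 3)).mul hlim4) (by
      filter_upwards [hkey, Ioo_mem_nhdsGT zero_lt_one] with s hs hs1
      obtain ⟨hT0, hTs, hlev⟩ := hT s hs1
      have e1 := hs (T s) hT0 hTs hlev
      have hs0 := hs1.1
      have e2 : ((1 - θ) ^ 2 * g) ^ 3 * T s ^ 3 ≤
          dirDeriv (timeDir n) (dirDeriv (timeDir n) v) (pt s 0) ^ 3 := by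
        rw [← mul_pow]; gcongr; exact e1
      have hv := (H.v_pos _ (pt_mem hs1)).le
      simp only [Function.comp_apply]
      rw [hlev, div_pow, ← pow_mul]
      have e3 : v (pt s 0) / T s ^ 3 *
          (dirDeriv (timeDir n) (dirDeriv (timeDir n) v) (pt s 0) ^ 3 / s ^ ((m + 1) * 3)) *
            s ^ (2 * m) = v (pt s 0) / s ^ (m + 3) *
          (dirDeriv (timeDir n) (dirDeriv (timeDir n) v) (pt s 0) ^ 3 / T s ^ 3) := by
        rw [show (m + 1) * 3 = (m + 3) + 2 * m by ring, pow_add s (m + 3)]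
        field_simp
      rw [e3, mul_comm (((1 - θ) ^ 2 * g) ^ 3)]
      gcongr
      rwa [le_div_iff₀ (by positivity)])
  rcases Nat.eq_zero_or_pos m with rfl | hm
  · have h3 := H.leading_coeff_le hε0 hε1 hh hshift hk hl
    have h4 : (dirDeriv (timeDir n))^[0 + 1] (dirDeriv (timeDir n) (dirDeriv (timeDir n) v)) 0
        = q := rfl
    rw [h4, ← hq, ← hg] at hlim
    simp only [Nat.factorial, mul_zero, pow_zero, mul_one] at hlim h3
    norm_num at hlim
    change q ≤ (1 - ε) ^ 3 * g at h3
    have h5 : ((1 - θ) ^ 3 * g) ^ 2 ≤ q ^ 2 := by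
      have e : ((1 - θ) ^ 2 * g) ^ 3 * (q / 6) = ((1 - θ) ^ 3 * g) ^ 2 * (g * q / 6) := by ring
      have e' : g / 6 * q ^ 3 = q ^ 2 * (g * q / 6) := by ring
      rw [e, e'] at hlim
      exact le_of_mul_le_mul_right hlim (by positivity)
    have h6 : (1 - θ) ^ 3 * g ≤ q := by
      refine (sq_le_sq₀ ?_ hvpos.le).1 h5
      have : 0 ≤ 1 - θ := by linarith
      positivity
    have h7 : (1 - ε) ^ 3 < (1 - θ) ^ 3 := by
      have e : 0 ≤ 1 - ε := by linarith
      gcongr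
      linarith
    have h8 := mul_lt_mul_of_pos_right h7 hpos
    linarith
  · rw [zero_pow (by omega), mul_zero] at hlim
    have : 0 < (1 - θ) := by linarith
    have hf : (0 : ℝ) < (m + 3).factorial := by exact_mod_cast (m + 3).factorial_pos
    have : 0 < ((1 - θ) ^ 2 * g) ^ 3 * (q / (m + 3).factorial) := by positivity
    linarith

end Admissible

theorem theorem2 (n : ℕ) (u v : SpaceTime n → ℝ)
    (hu : ContDiffOn ℝ ∞ u (closure (domainΩ n)))
    (hv : ContDiffOn ℝ ∞ v (closure (domainΩ n)))
    (huv : ∀ p ∈ domainΩ n, v p ≤ u p)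
    (hupos : ∀ p ∈ domainΩ n, 0 < u p)
    (hvpos : ∀ p ∈ domainΩ n, 0 < v p)
    (hut : ∀ (t : ℝ) (y : EuclideanSpace ℝ (Fin n)), pt t y ∈ domainΩ n →
      0 < deriv (fun τ : ℝ => u (pt τ y)) t)
    (hu0 : ∀ y : EuclideanSpace ℝ (Fin n), ‖y‖ < 1 → u (pt 0 y) = 0)
    (hmain : MainCondition u v)
    (hut0 : timeDerivZero 1 u 0 = 0)
    (k l : ℕ) (hk : IsVanishingOrder u k) (hl : IsVanishingOrder v l)
    (hextra : ∇ (timeDerivZero 2 u) 0 = 0)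
    (hk23 : k = 2 ∨ k = 3) :
    EqOn u v (closure (domainΩ n)) := by
  have H : Admissible u v := by
    refine ⟨hu, hv, huv, hvpos, fun p hp => ?_, hu0, hmain⟩
    have h1 := hut p.fst p.snd hp
    rwa [((hasDerivWithinAt_time hu hp.2.2.le ⟨hp.1.le, hp.2.1.le⟩).hasDerivAt
      (Icc_mem_nhds hp.1 hp.2.1)).deriv] at h1
  have hzero : ∀ w : SpaceTime n → ℝ, ContDiffOn ℝ ∞ w (closure (domainΩ n)) → ∀ i,
      timeDerivZero i w 0 = (dirDeriv (timeDir n))^[i] w 0 := fun w hw i =>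
    timeDerivZero_eq hw (by simp) i
  have hki : ∀ i < k, (dirDeriv (timeDir n))^[i] u 0 = 0 := fun i hi => hzero u hu i ▸ hk.1 i hi
  have hk' : (dirDeriv (timeDir n))^[k] u 0 ≠ 0 := hzero u hu k ▸ hk.2
  have hli : ∀ i < l, (dirDeriv (timeDir n))^[i] v 0 = 0 := fun i hi => hzero v hv i ▸ hl.1 i hi
  have hl' : (dirDeriv (timeDir n))^[l] v 0 ≠ 0 := hzero v hv l ▸ hl.2
  by_contra hne
  have hex : ∃ p ∈ domainΩ n, v p < u p := by
    by_contra! hle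
    have heq : EqOn u v (domainΩ n) := fun p hp => le_antisymm (hle p hp) (huv p hp)
    exact hne (heq.of_subset_closure hu.continuousOn hv.continuousOn subset_closure subset_rfl)
  have hlt := H.lt_of_exists_lt hex
  have hkl := H.order_le hki hli hl'
  rcases hk23 with rfl | rfl
  · exact H.second_order_impossible hlt hki hk' fun i hi => hli i (hi.trans_le hkl)
  · obtain ⟨m, rfl⟩ := Nat.exists_eq_add_of_le' hkl
    refine H.third_order_impossible hlt hki hk' (fun z => ?_) hli hl'
    have hutt := contDiffOn_dirDeriv (contDiffOn_dirDeriv hu (timeDir n)) (timeDir n)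
    have hd := hasFDerivAt_slice hutt (y := 0) (by simp)
    have heq : timeDerivZero 2 u =ᶠ[𝓝 0]
        fun y => dirDeriv (timeDir n) (dirDeriv (timeDir n) u) (pt 0 y) := by
      filter_upwards [Metric.isOpen_ball.mem_nhds
        (mem_ball_zero_iff.2 (by simp : ‖(0 : EuclideanSpace ℝ (Fin n))‖ < 1))] with y hy
      exact timeDerivZero_eq hu (mem_ball_zero_iff.1 hy).le 2
    have hgrad := (hd.congr_of_eventuallyEq heq).differentiableAt.hasGradientAt
    rw [hextra] at hgrad
    have h0 := (hgrad.hasFDerivAt.congr_of_eventuallyEq heq.symm)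
    rw [map_zero] at h0
    exact dirDeriv_slice_of_hasFDerivAt_zero hutt (by simp) h0 z
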